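/- Let $\mathcal H$ be a complex Hilbert space, let $t\ge 0$, and let $A:[0,t]\to\mathcal B(\mathcal H)$ be a (Bochner) integrable function with values in the bounded operators on $\mathcal H$, with the operator norm. For $\varepsilon\in\mathbb C$ let $Y(s;\varepsilon)$, $0\le s\le t$, be the solution of $\frac{dY}{ds}=\varepsilon A(s)Y$, $Y(0)=I$, that is, the continuous solution of $Y(s;\varepsilon)=I+\varepsilon\int_0^s A(r)Y(r;\varepsilon)\,dr$. Put $$B_\pi=\Big\{\varepsilon\in\mathbb C : |\varepsilon|\int_0^t\|A(s)\|\,ds<\pi\Big\}.$$ For a bounded operator $T$ whose spectrum does not meet $(-\infty,0]$ let $$\log T=\frac1{2\pi i}\oint_\Gamma \log z\,(zI-T)^{-1}\,dz$$ be the principal logarithm of $T$; here $\log z$ is the principal branch and $\Gamma$ is the positively oriented boundary of a region $\{e^{-R}<|z|<e^{R},\ |\arg z|<\theta\}$ with $R>0$ and $0<\theta<\pi$ that contains the spectrum of $T$. If $\mathcal H$ is finite dimensional, then for every $\varepsilon\in B_\pi$ the logarithm $\varphi(\varepsilon)=\log Y(t;\varepsilon)$ is defined and $\exp\varphi(\varepsilon)=Y(t;\varepsilon)$,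 and $\varphi$ is an analytic function of $\varepsilon$ in $B_\pi$. If $\mathcal H$ is infinite dimensional, the same holds near every point $\varepsilon_0\in B_\pi$ for which the operator $Y(t;\varepsilon_0)$ is normal: in a neighbourhood of $\varepsilon_0$, $\varphi$ is defined and analytic and $\exp\varphi(\varepsilon)=Y(t;\varepsilon)$. In particular, $\varphi$ is analytic in all of $B_\pi$ if $Y(t;\varepsilon)$ is normal for every $\varepsilon\in B_\pi$. -/

import Mathlib

open MeasureTheory

namespace Magnus

noncomputable section

/-- `Y` is the solution on `[0, t]` of `Y' = ε A(s) Y`, `Y(0) = I`, in integral form: `Y` is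
(norm) continuous and `Y(s) = I + ε ∫₀ˢ A(r) Y(r) dr`. For continuous `A` this is the classical
notion, for integrable `A` it is the usual (absolutely continuous) one. -/
structure IsSolution {H : Type*} [NormedAddCommGroup H] [InnerProductSpace ℂ H]
    [CompleteSpace H] (A : ℝ → H →L[ℂ] H) (ε : ℂ) (t : ℝ) (Y : ℝ → H →L[ℂ] H) : Prop where
  continuousOn : ContinuousOn Y (Set.Icc 0 t)
  integral_eq : ∀ s ∈ Set.Icc 0 t, Y s = 1 + ε • ∫ r in (0 : ℝ)..s, A r * Y r

/-- The set `B_γ` of all complex `ε` with `|ε| ∫₀ᵗ ‖A(s)‖ ds < γ`. -/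
def disc {H : Type*} [NormedAddCommGroup H] [InnerProductSpace ℂ H]
    (A : ℝ → H →L[ℂ] H) (t γ : ℝ) : Set ℂ :=
  {ε : ℂ | ‖ε‖ * ∫ s in (0 : ℝ)..t, ‖A s‖ < γ}

/-- The open annular sector `e^{-R} < |z| < e^R`, `|arg z| < θ`. -/
def annularSector (R θ : ℝ) : Set ℂ :=
  {z : ℂ | Real.exp (-R) < ‖z‖ ∧ ‖z‖ < Real.exp R ∧ |z.arg| < θ}

/-- The contour integral of `f` along the boundary of `annularSector R θ`, counterclockwise:
the lower ray outwards, the outer arc, the upper ray inwards, the inner arc backwards. -/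
def sectorContourIntegral {E : Type*} [NormedAddCommGroup E] [NormedSpace ℂ E]
    (R θ : ℝ) (f : ℂ → E) : E :=
  (∫ r in Real.exp (-R)..Real.exp R,
      Complex.exp (-(θ * Complex.I)) • f (r * Complex.exp (-(θ * Complex.I))))
  + (∫ ω in (-θ)..θ,
      (Complex.I * Real.exp R * Complex.exp (ω * Complex.I)) •
        f (Real.exp R * Complex.exp (ω * Complex.I)))
  - (∫ r in Real.exp (-R)..Real.exp R,
      Complex.exp (θ * Complex.I) • f (r * Complex.exp (θ * Complex.I)))
  - (∫ ω in (-θ)..θ,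
      (Complex.I * Real.exp (-R) * Complex.exp (ω * Complex.I)) •
        f (Real.exp (-R) * Complex.exp (ω * Complex.I)))

/-- The boundary of `annularSector R θ` lies in the domain of the principal logarithm
and encloses the spectrum of `T`. -/
def IsLogContour {H : Type*} [NormedAddCommGroup H] [InnerProductSpace ℂ H]
    (T : H →L[ℂ] H) (R θ : ℝ) : Prop :=
  0 < R ∧ 0 < θ ∧ θ < Real.pi ∧ spectrum ℂ T ⊆ annularSector R θ

/-- The principal logarithm of `T` is defined: some contour as above encloses the spectrum.
(As the spectrum is compact, this says that it does not meet the half-line `(-∞, 0]`.) -/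
def LogDefined {H : Type*} [NormedAddCommGroup H] [InnerProductSpace ℂ H]
    (T : H →L[ℂ] H) : Prop :=
  ∃ p : ℝ × ℝ, IsLogContour T p.1 p.2

open Classical in
/-- The principal logarithm of a bounded operator,
`log T = (2πi)⁻¹ ∮ log z (z I - T)⁻¹ dz`, over a contour in the domain of the principal branch
of `log z` that encloses the spectrum of `T`. By Cauchy's theorem the choice of
the contour is immaterial. The value is `0` if there is no such contour. -/
def opLog {H : Type*} [NormedAddCommGroup H] [InnerProductSpace ℂ H]
    (T : H →L[ℂ] H) : H →L[ℂ] H :=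
  if h : LogDefined T then
    (2 * Real.pi * Complex.I : ℂ)⁻¹ •
      sectorContourIntegral h.choose.1 h.choose.2 (fun z => Complex.log z • resolvent T z)
  else 0

end

end Magnus

/-!
Write `m(s) = |ε| ∫₀ˢ ‖A‖` (`growth`). A trajectory `s ↦ Y(s) x` has speed at most `‖ε A‖` times
its length, so it turns, in the real Hilbert space underlying `H`, by an angle of at most
`m(t)`, and it stays away from `0`. If `m(t) < π`, no operator `(1 - u) + u Y(t)`, `0 ≤ u ≤ 1`, can
nearly annihilate a vector `x`, because that would need `Y(t) x` to point in the direction of `-x`.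
These operators are therefore bounded below (`exists_le_norm_segmentPath`), and, when `H` is finite
dimensional or `Y(t)` is normal, invertible (`IsSolution.segmentUnits`).

Invertibility of the whole segment from `1` to `T` (`SegmentUnits T`) says that the spectrum of `T`
avoids `(-∞, 0]`, and it is the only spectral condition needed. It is equivalent to invertibility in
the Banach algebra `C([0, 1], 𝔸)`, hence open in `T`, and
`segmentLog T = ∫₀¹ (T - 1) (1 + u (T - 1))⁻¹ du` is analytic in `T` there. Differentiating
`exp (-L(v)) (1 + v (T - 1))`, where `L(v)` is the integral over `[0, v]`, gives
`exp (segmentLog T) = T`.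

The contour integral defining `opLog T` equals `segmentLog T` for every admissible contour
(`sectorContourIntegral_log`). Indeed `(log z - segmentLog T) (z - T)⁻¹` extends holomorphically
to the slit plane, so its contour integral vanishes, and the contour integral of `(z - T)⁻¹` is `2πi`
(`rectIntegral_resolvent`). In the coordinate `w = log z` the contour is a rectangle and only
Cauchy's theorem for rectangles is used.

Finally `Y(t; ε)` is the sum of its Dyson series (`hasSum_dysonCoeff`), hence entire in `ε`, and so
`ε ↦ opLog (Y(t; ε))` agrees near `ε₀` with the composition of two analytic maps. As `A` is only
integrable, estimates over `[0, t]` are obtained by comparing increments over short intervals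
(`le_of_eventually_sub_le_sub`) instead of by differentiation.
-/

namespace Magnus

open Set Filter Topology

-- Angles between vectors of `H` refer to the real inner product `re ⟪x, y⟫`.
attribute [local instance] InnerProductSpace.complexToReal

/-! ### The logarithm as an integral along a segment -/

section SegmentLog

variable {𝔸 : Type*} [NormedRing 𝔸] [NormedAlgebra ℂ 𝔸]

/-- The segment from `1` to `T`, parametrized by `u ∈ [0, 1]`. -/
noncomputable def segmentPath (T : 𝔸) (u : ℝ) : 𝔸 := 1 + (u : ℂ) • (T - 1)

/-- All elements of the segment from `1` to `T` are invertible. Equivalently, the spectrum of `T`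
does not meet `(-∞, 0]`. -/
def SegmentUnits (T : 𝔸) : Prop := ∀ u ∈ Icc (0 : ℝ) 1, IsUnit (segmentPath T u)

/-- The primitive `∫₀ᵛ (T - 1) (1 + u (T - 1))⁻¹ du` of the logarithmic derivative of
`segmentPath T`. -/
noncomputable def segmentPrimitive (T : 𝔸) (v : ℝ) : 𝔸 :=
  (T - 1) * ∫ u in (0 : ℝ)..v, Ring.inverse (segmentPath T u)

/-- The logarithm of `T` as an integral along the segment from `1` to `T`. -/
noncomputable def segmentLog (T : 𝔸) : 𝔸 := segmentPrimitive T 1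

theorem continuous_segmentPath (T : 𝔸) : Continuous (segmentPath T) := by
  unfold segmentPath; fun_prop

theorem commute_segmentPath {T x : 𝔸} (h : Commute x T) (u : ℝ) :
    Commute x (segmentPath T u) :=
  (Commute.one_right x).add_right ((h.sub_right (Commute.one_right x)).smul_right _)

theorem commute_inverse {R : Type*} [MonoidWithZero R] {x y : R} (h : Commute x y) :
    Commute x (Ring.inverse y) := by
  by_cases hy : IsUnit y
  · obtain ⟨y, rfl⟩ := hy
    rw [Ring.inverse_unit]
    exact h.units_inv_right
  · rw [Ring.inverse_non_unit _ hy]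
    exact Commute.zero_right x

/-- `segmentPath T` as an element of the Banach algebra `C([0, 1], 𝔸)`. -/
noncomputable def segmentMap (T : 𝔸) : C(unitInterval, 𝔸) :=
  1 + (⟨fun u => ((u : ℝ) : ℂ) • (1 : 𝔸), by fun_prop⟩ : C(unitInterval, 𝔸)) *
    (ContinuousLinearMap.const ℂ unitInterval T - 1)

theorem segmentMap_apply (T : 𝔸) (u : unitInterval) : segmentMap T u = segmentPath T u := by
  simp [segmentMap, segmentPath]

theorem analyticAt_segmentMap (T : 𝔸) : AnalyticAt ℂ (segmentMap : 𝔸 → C(unitInterval, 𝔸)) T :=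
  analyticAt_const.add (analyticAt_const.mul
    (((ContinuousLinearMap.const ℂ unitInterval : 𝔸 →L[ℂ] C(unitInterval, 𝔸)).analyticAt T).sub
      analyticAt_const))

variable [CompleteSpace 𝔸]

theorem commute_intervalIntegral {x : 𝔸} {f : ℝ → 𝔸} {a b : ℝ} (h : ∀ u, Commute x (f u)) :
    Commute x (∫ u in a..b, f u) := by
  by_cases hf : IntervalIntegrable f volume a b
  · have h1 := (ContinuousLinearMap.mul ℂ 𝔸 x).intervalIntegral_comp_comm hf
    have h2 := ((ContinuousLinearMap.mul ℂ 𝔸).flip x).intervalIntegral_comp_comm hf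
    simp only [ContinuousLinearMap.mul_apply', ContinuousLinearMap.flip_apply] at h1 h2
    rw [Commute, SemiconjBy, ← h1, ← h2]
    simp only [(h _).eq]
  · rw [intervalIntegral.integral_undef hf]
    exact Commute.zero_right x

theorem commute_segmentPrimitive {T x : 𝔸} (h : Commute x T) (v : ℝ) :
    Commute x (segmentPrimitive T v) :=
  (h.sub_right (Commute.one_right x)).mul_right
    (commute_intervalIntegral fun u => commute_inverse (commute_segmentPath h u))

/-- Derivative of `exp ∘ L` at a point where the values of `L` commute. -/
theorem hasDerivAt_exp_of_commute {L : ℝ → 𝔸} {L' : 𝔸} {v : ℝ} (h : HasDerivAt L L' v)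
    (hc : ∀ w, Commute (L v) (L w)) :
    HasDerivAt (fun w => NormedSpace.exp (L w)) (NormedSpace.exp (L v) * L') v := by
  let _ : NormedAlgebra ℚ 𝔸 := NormedAlgebra.restrictScalars ℚ ℂ 𝔸
  have h0 : HasFDerivAt (NormedSpace.exp : 𝔸 → 𝔸) (1 : 𝔸 →L[ℝ] 𝔸) (L v - L v) := by
    rw [sub_self]; exact hasFDerivAt_exp_zero
  have h1 : HasDerivAt (fun w => NormedSpace.exp (L w - L v)) L' v :=
    HasFDerivAt.comp_hasDerivAt (f := fun w => L w - L v) v h0 (h.sub_const (L v))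
  have h2 := h1.const_mul (NormedSpace.exp (L v))
  refine h2.congr_of_eventuallyEq (Eventually.of_forall fun w => ?_)
  change _ = NormedSpace.exp (L v) * NormedSpace.exp (L w - L v)
  rw [← NormedSpace.exp_add_of_commute ((hc w).sub_right (Commute.refl _)), add_sub_cancel]

theorem continuousAt_inverse_segmentPath {T : 𝔸} {u : ℝ} (h : IsUnit (segmentPath T u)) :
    ContinuousAt (fun u => Ring.inverse (segmentPath T u)) u := by
  have h1 : ContinuousAt Ring.inverse (segmentPath T u) := by
    obtain ⟨y, hy⟩ := h
    rw [← hy]; exact NormedRing.inverse_continuousAt y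
  exact ContinuousAt.comp (f := segmentPath T) h1 (continuous_segmentPath T).continuousAt

theorem SegmentUnits.continuousOn {T : 𝔸} (h : SegmentUnits T) :
    ContinuousOn (fun u => Ring.inverse (segmentPath T u)) (Icc 0 1) := fun u hu =>
  (continuousAt_inverse_segmentPath (h u hu)).continuousWithinAt

theorem SegmentUnits.hasDerivAt {T : 𝔸} (h : SegmentUnits T) {v : ℝ} (hv : v ∈ Icc (0 : ℝ) 1) :
    HasDerivAt (segmentPrimitive T) ((T - 1) * Ring.inverse (segmentPath T v)) v := by
  refine (intervalIntegral.integral_hasDerivAt_right ?_ ?_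
    (continuousAt_inverse_segmentPath (h v hv))).const_mul (T - 1)
  · exact (h.continuousOn.mono (by rw [uIcc_of_le hv.1]; exact Icc_subset_Icc_right hv.2)
      ).intervalIntegrable
  · have ho : IsOpen {u | IsUnit (segmentPath T u)} :=
      Units.isOpen.preimage (continuous_segmentPath T)
    exact ContinuousOn.stronglyMeasurableAtFilter ho
      (fun u hu => (continuousAt_inverse_segmentPath hu).continuousWithinAt) v (h v hv)

/-- The function `exp (-L(v)) (1 + v (T - 1))`, where `L = segmentPrimitive T`, has derivative
zero, hence the value `1` at `v = 1`. -/
theorem SegmentUnits.exp_segmentLog {T : 𝔸} (h : SegmentUnits T) :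
    NormedSpace.exp (segmentLog T) = T := by
  let _ : NormedAlgebra ℚ 𝔸 := NormedAlgebra.restrictScalars ℚ ℂ 𝔸
  set F : ℝ → 𝔸 := fun v => NormedSpace.exp (-segmentPrimitive T v) * segmentPath T v
  have hF : ∀ v ∈ Icc (0 : ℝ) 1, HasDerivAt F 0 v := by
    intro v hv
    have h1 := hasDerivAt_exp_of_commute (h.hasDerivAt hv).fun_neg fun w =>
      ((commute_segmentPrimitive
        (commute_segmentPrimitive (Commute.refl T) v).symm w).neg_left).neg_right
    have h2 : HasDerivAt (segmentPath T) (T - 1) v := by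
      have := ((Complex.ofRealCLM.hasDerivAt (x := v)).smul_const (T - 1)).const_add (1 : 𝔸)
      rwa [Complex.ofRealCLM_apply, Complex.ofReal_one, one_smul] at this
    refine (h1.mul h2).congr_deriv ?_
    rw [mul_assoc, neg_mul, mul_assoc (T - 1), Ring.inverse_mul_cancel _ (h v hv), mul_one, mul_neg,
      neg_add_cancel]
  have h1 := constant_of_has_deriv_right_zero
    (fun v hv => (hF v hv).continuousAt.continuousWithinAt)
    (fun v hv => (hF v (Ico_subset_Icc_self hv)).hasDerivWithinAt) 1 (right_mem_Icc.2 zero_le_one)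
  have h2 : NormedSpace.exp (-segmentLog T) * T = 1 := by
    simpa [F, segmentPath, segmentPrimitive, segmentLog] using h1
  have h3 : NormedSpace.exp (segmentLog T) * NormedSpace.exp (-segmentLog T) = 1 := by
    rw [← NormedSpace.exp_add_of_commute (Commute.refl _).neg_right, add_neg_cancel,
      NormedSpace.exp_zero]
  rw [← mul_one (NormedSpace.exp (segmentLog T)), ← h2, ← mul_assoc, h3, one_mul]

theorem isUnit_segmentMap_iff {T : 𝔸} : IsUnit (segmentMap T) ↔ SegmentUnits T := by
  rw [ContinuousMap.isUnit_iff_forall_isUnit]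
  simp only [segmentMap_apply]
  exact ⟨fun h u hu => h ⟨u, hu⟩, fun h u => h u u.2⟩

/-- Invertible elements of `C([0, 1], 𝔸)` form an open set. -/
theorem SegmentUnits.eventually {T : 𝔸} (h : SegmentUnits T) : ∀ᶠ S in 𝓝 T, SegmentUnits S := by
  have := (analyticAt_segmentMap T).continuousAt.eventually
    (Units.isOpen.mem_nhds (isUnit_segmentMap_iff.2 h))
  exact this.mono fun S hS => isUnit_segmentMap_iff.1 hS

theorem SegmentUnits.inverse_segmentMap_apply {T : 𝔸} (h : SegmentUnits T) (u : unitInterval) :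
    Ring.inverse (segmentMap T) u = Ring.inverse (segmentPath T u) := by
  have h1 := congrArg (fun f : C(unitInterval, 𝔸) => f u)
    (Ring.inverse_mul_cancel _ (isUnit_segmentMap_iff.2 h))
  simp only [ContinuousMap.mul_apply, segmentMap_apply, ContinuousMap.one_apply] at h1
  rw [← mul_one (Ring.inverse (segmentMap T) u), ← Ring.mul_inverse_cancel _ (h u u.2),
    ← mul_assoc, h1, one_mul]

/-- The integral over `[0, 1]` as a bounded functional on `C([0, 1], 𝔸)`. -/
noncomputable def integralCLM : C(unitInterval, 𝔸) →L[ℂ] 𝔸 :=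
  LinearMap.mkContinuous
    { toFun := fun f => ∫ u in (0 : ℝ)..1, f (projIcc 0 1 zero_le_one u)
      map_add' := fun f g => intervalIntegral.integral_add
        ((f.continuous.comp continuous_projIcc).intervalIntegrable _ _)
        ((g.continuous.comp continuous_projIcc).intervalIntegrable _ _)
      map_smul' := fun c f => intervalIntegral.integral_smul c _ } 1 fun f => by
    have := intervalIntegral.norm_integral_le_of_norm_le_const (a := (0 : ℝ)) (b := 1)
      (f := fun u => f (projIcc 0 1 zero_le_one u)) (C := ‖f‖) fun u _ => f.norm_coe_le_norm _
    simpa using this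

/-- Analyticity of `T ↦ ∫₀¹ (1 + u (T - 1))⁻¹ c(u) du`: the path `u ↦ 1 + u (T - 1)` is an affine
function of `T` with values in the Banach algebra `C([0, 1], 𝔸)`, inversion in that algebra is
analytic, and integration is linear. -/
theorem SegmentUnits.analyticAt_integral {T : 𝔸} (h : SegmentUnits T) {c : ℝ → 𝔸}
    (hc : ContinuousOn c (Icc 0 1)) :
    AnalyticAt ℂ (fun S => ∫ u in (0 : ℝ)..1, Ring.inverse (segmentPath S u) * c u) T := by
  have hu := isUnit_segmentMap_iff.2 h
  have h1 : AnalyticAt ℂ (Ring.inverse : C(unitInterval, 𝔸) → _) (segmentMap T) := by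
    obtain ⟨y, hy⟩ := hu
    rw [← hy]; exact analyticAt_inverse y
  have h2 := (h1.comp (analyticAt_segmentMap T)).mul
    (analyticAt_const (v := (⟨fun u => c u, hc.domRestrict⟩ : C(unitInterval, 𝔸))))
  have h3 := (ContinuousLinearMap.analyticAt integralCLM _).comp h2
  refine h3.congr (h.eventually.mono fun S hS => ?_)
  refine intervalIntegral.integral_congr fun u hu => ?_
  rw [uIcc_of_le zero_le_one] at hu
  simp [projIcc_of_mem zero_le_one hu, hS.inverse_segmentMap_apply]
  rfl

theorem SegmentUnits.analyticAt_segmentLog {T : 𝔸} (h : SegmentUnits T) :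
    AnalyticAt ℂ segmentLog T := by
  have := h.analyticAt_integral (c := fun _ => 1) continuousOn_const
  simp only [mul_one] at this
  exact (analyticAt_id.sub analyticAt_const).mul this

end SegmentLog

/-! ### Contour integrals in logarithmic coordinates -/

section Rectangle

variable {E : Type*} [NormedAddCommGroup E]

/-- The boundary of the rectangle `[a, b] × [c, d]`. -/
def rectBoundary (a b c d : ℝ) : Set ℂ :=
  {w | w.re ∈ Icc a b ∧ w.im ∈ Icc c d ∧ ¬(w.re ∈ Ioo a b ∧ w.im ∈ Ioo c d)}

theorem horizontal_mem {S : Set ℂ} {a b m : ℝ} (hab : a ≤ b)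
    (hS : ∀ w : ℂ, w.re ∈ Icc a b → w.im = m → w ∈ S) :
    ∀ x ∈ uIcc a b, ((x : ℂ) + m * Complex.I) ∈ S := fun x hx =>
  hS _ (by simpa [uIcc_of_le hab] using hx) (by simp)

theorem vertical_mem {S : Set ℂ} {c d m : ℝ} (hcd : c ≤ d)
    (hS : ∀ w : ℂ, w.re = m → w.im ∈ Icc c d → w ∈ S) :
    ∀ y ∈ uIcc c d, ((m : ℂ) + (y : ℝ) * Complex.I) ∈ S := fun x hx =>
  hS _ (by simp) (by simpa [uIcc_of_le hcd] using hx)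

theorem intervalIntegrable_horizontal {S : Set ℂ} {h : ℂ → E} (hh : ContinuousOn h S)
    {a b m : ℝ} (hab : a ≤ b) (hS : ∀ w : ℂ, w.re ∈ Icc a b → w.im = m → w ∈ S) :
    IntervalIntegrable (fun x : ℝ => h (x + m * Complex.I)) volume a b :=
  (hh.comp (by fun_prop) (horizontal_mem hab hS)).intervalIntegrable

theorem intervalIntegrable_vertical {S : Set ℂ} {h : ℂ → E} (hh : ContinuousOn h S)
    {c d m : ℝ} (hcd : c ≤ d) (hS : ∀ w : ℂ, w.re = m → w.im ∈ Icc c d → w ∈ S) :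
    IntervalIntegrable (fun y : ℝ => h (m + y * Complex.I)) volume c d :=
  (hh.comp (by fun_prop) (vertical_mem hcd hS)).intervalIntegrable

variable [NormedSpace ℂ E]

/-- The integral of `h` along the boundary of `[a, b] × [c, d]`, counterclockwise. -/
noncomputable def rectIntegral (a b c d : ℝ) (h : ℂ → E) : E :=
  (∫ x in a..b, h (x + c * Complex.I)) - (∫ x in a..b, h (x + d * Complex.I)) +
    Complex.I • (∫ y in c..d, h (b + y * Complex.I)) -
    Complex.I • (∫ y in c..d, h (a + y * Complex.I))

section

variable {a b c d : ℝ}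

theorem mem_rectBoundary_bottom (hcd : c ≤ d) (w : ℂ) (h1 : w.re ∈ Icc a b) (h2 : w.im = c) :
    w ∈ rectBoundary a b c d :=
  ⟨h1, by simp [h2, hcd], fun h => by simp [h2] at h⟩

theorem mem_rectBoundary_top (hcd : c ≤ d) (w : ℂ) (h1 : w.re ∈ Icc a b) (h2 : w.im = d) :
    w ∈ rectBoundary a b c d :=
  ⟨h1, by simp [h2, hcd], fun h => by simp [h2] at h⟩

theorem mem_rectBoundary_left (hab : a ≤ b) (w : ℂ) (h1 : w.re = a) (h2 : w.im ∈ Icc c d) :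
    w ∈ rectBoundary a b c d :=
  ⟨by simp [h1, hab], h2, fun h => by simp [h1] at h⟩

theorem mem_rectBoundary_right (hab : a ≤ b) (w : ℂ) (h1 : w.re = b) (h2 : w.im ∈ Icc c d) :
    w ∈ rectBoundary a b c d :=
  ⟨by simp [h1, hab], h2, fun h => by simp [h1] at h⟩

theorem rectIntegral_congr (hab : a ≤ b) (hcd : c ≤ d) {h k : ℂ → E}
    (hhk : EqOn h k (rectBoundary a b c d)) : rectIntegral a b c d h = rectIntegral a b c d k := by
  unfold rectIntegral
  congr 1
  · congr 1
    · congr 1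
      · exact intervalIntegral.integral_congr fun x hx =>
          hhk (horizontal_mem hab (mem_rectBoundary_bottom hcd) x hx)
      · exact intervalIntegral.integral_congr fun x hx =>
          hhk (horizontal_mem hab (mem_rectBoundary_top hcd) x hx)
    · congr 1
      exact intervalIntegral.integral_congr fun x hx =>
        hhk (vertical_mem hcd (mem_rectBoundary_right hab) x hx)
  · congr 1
    exact intervalIntegral.integral_congr fun x hx =>
      hhk (vertical_mem hcd (mem_rectBoundary_left hab) x hx)

theorem rectIntegral_add (hab : a ≤ b) (hcd : c ≤ d) {h k : ℂ → E}
    (hh : ContinuousOn h (rectBoundary a b c d)) (hk : ContinuousOn k (rectBoundary a b c d)) :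
    rectIntegral a b c d (fun w => h w + k w) =
      rectIntegral a b c d h + rectIntegral a b c d k := by
  unfold rectIntegral
  rw [intervalIntegral.integral_add, intervalIntegral.integral_add, intervalIntegral.integral_add,
    intervalIntegral.integral_add]
  · simp only [smul_add]; abel
  · exact intervalIntegrable_vertical hh hcd (mem_rectBoundary_left hab)
  · exact intervalIntegrable_vertical hk hcd (mem_rectBoundary_left hab)
  · exact intervalIntegrable_vertical hh hcd (mem_rectBoundary_right hab)
  · exact intervalIntegrable_vertical hk hcd (mem_rectBoundary_right hab)
  · exact intervalIntegrable_horizontal hh hab (mem_rectBoundary_top hcd)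
  · exact intervalIntegrable_horizontal hk hab (mem_rectBoundary_top hcd)
  · exact intervalIntegrable_horizontal hh hab (mem_rectBoundary_bottom hcd)
  · exact intervalIntegrable_horizontal hk hab (mem_rectBoundary_bottom hcd)

theorem rectIntegral_clm [CompleteSpace E] (hab : a ≤ b) (hcd : c ≤ d) {h : ℂ → E}
    (hh : ContinuousOn h (rectBoundary a b c d)) (L : E →L[ℂ] E) :
    rectIntegral a b c d (fun w => L (h w)) = L (rectIntegral a b c d h) := by
  unfold rectIntegral
  rw [L.intervalIntegral_comp_comm, L.intervalIntegral_comp_comm, L.intervalIntegral_comp_comm,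
    L.intervalIntegral_comp_comm]
  · simp only [map_add, map_sub, map_smul]
  · exact intervalIntegrable_vertical hh hcd (mem_rectBoundary_left hab)
  · exact intervalIntegrable_vertical hh hcd (mem_rectBoundary_right hab)
  · exact intervalIntegrable_horizontal hh hab (mem_rectBoundary_top hcd)
  · exact intervalIntegrable_horizontal hh hab (mem_rectBoundary_bottom hcd)

theorem rectIntegral_eq_zero (hab : a ≤ b) (hcd : c ≤ d) {h : ℂ → E}
    (hh : ∀ w : ℂ, w.re ∈ Icc a b → w.im ∈ Icc c d → DifferentiableAt ℂ h w) :
    rectIntegral a b c d h = 0 := by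
  refine Complex.integral_boundary_rect_eq_zero_of_differentiableOn h ⟨a, c⟩ ⟨b, d⟩ fun w hw => ?_
  rw [uIcc_of_le hab, uIcc_of_le hcd] at hw
  exact (hh w hw.1 hw.2).differentiableWithinAt

end

/-- The pullback under `z = exp w` of the form `f z dz`. -/
noncomputable def expPullback (f : ℂ → E) (w : ℂ) : E := Complex.exp w • f (Complex.exp w)

/-- Substitution `r = e^x` on the ray `arg z = τ`. -/
theorem integral_ray_eq (R τ : ℝ) (hR : 0 ≤ R) {f : ℂ → E}
    (hf : ∀ x ∈ Icc (-R) R, ContinuousAt f (Complex.exp (x + τ * Complex.I))) :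
    (∫ r in Real.exp (-R)..Real.exp R,
      Complex.exp (τ * Complex.I) • f (r * Complex.exp (τ * Complex.I))) =
    ∫ x in (-R)..R, expPullback f (x + τ * Complex.I) := by
  rw [← intervalIntegral.integral_deriv_smul_comp' (fun x _ => Real.hasDerivAt_exp x)
    Real.continuous_exp.continuousOn]
  · refine intervalIntegral.integral_congr fun x _ => ?_
    simp only [Function.comp, expPullback, Complex.exp_add, Complex.ofReal_exp, mul_smul]
    rw [← Complex.coe_smul, Complex.ofReal_exp]
  · rintro _ ⟨x, hx, rfl⟩
    rw [uIcc_of_le (by linarith)] at hx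
    have h1 := hf x hx
    rw [Complex.exp_add, ← Complex.ofReal_exp] at h1
    refine ((ContinuousAt.comp (f := fun r : ℝ => (r : ℂ) * Complex.exp (τ * Complex.I))
      h1 (by fun_prop)).const_smul _).continuousWithinAt

theorem sectorContourIntegral_eq (R θ : ℝ) (hR : 0 ≤ R) (hθ : 0 ≤ θ) {f : ℂ → E}
    (hf : ∀ w ∈ rectBoundary (-R) R (-θ) θ, ContinuousAt f (Complex.exp w)) :
    sectorContourIntegral R θ f = rectIntegral (-R) R (-θ) θ (expPullback f) := by
  have hR' : -R ≤ R := by linarith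
  have hθ' : -θ ≤ θ := by linarith
  have h1 := integral_ray_eq R (-θ) hR (f := f) fun x hx =>
    hf _ (mem_rectBoundary_bottom hθ' _ (by simpa using hx) (by simp))
  have h2 := integral_ray_eq R θ hR (f := f) fun x hx =>
    hf _ (mem_rectBoundary_top hθ' _ (by simpa using hx) (by simp))
  have h3 : ∀ ρ : ℝ, (∫ ω in (-θ)..θ, (Complex.I * Real.exp ρ * Complex.exp (ω * Complex.I)) •
      f (Real.exp ρ * Complex.exp (ω * Complex.I))) =
      Complex.I • ∫ y in (-θ)..θ, expPullback f (ρ + y * Complex.I) := by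
    intro ρ
    rw [← intervalIntegral.integral_smul]
    simp only [expPullback, Complex.exp_add, Complex.ofReal_exp, smul_smul, mul_assoc]
  rw [Complex.ofReal_neg, neg_mul] at h1
  rw [sectorContourIntegral, rectIntegral, h1, h2, h3, h3]
  simp only [Complex.ofReal_neg, neg_mul]
  abel

end Rectangle

/-! ### The contour integral of the resolvent -/

section Contour

variable {𝔸 : Type*} [NormedRing 𝔸] [NormedAlgebra ℂ 𝔸] {T : 𝔸} {R θ : ℝ}

/-- The strip `-θ ≤ Im w ≤ 2π - θ` is a period strip of `exp`; in it the exponential maps only the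
rectangle `|Re w| < R`, `|Im w| < θ` into the sector. -/
theorem exp_notMem_annularSector (hθπ : θ < Real.pi) {w : ℂ} (h1 : -θ ≤ w.im)
    (h2 : w.im ≤ 2 * Real.pi - θ) (h3 : ¬(w.re ∈ Ioo (-R) R ∧ w.im ∈ Ioo (-θ) θ)) :
    Complex.exp w ∉ annularSector R θ := by
  rintro ⟨e1, e2, e3⟩
  rw [Complex.norm_exp, Real.exp_lt_exp] at e1 e2
  obtain ⟨n, hn⟩ := Complex.exp_eq_exp_iff_exists_int.1
    (Complex.exp_log (Complex.exp_ne_zero w)).symm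
  have him := congrArg Complex.im hn
  simp only [Complex.add_im, Complex.log_im, Complex.mul_im, Complex.mul_re, Complex.intCast_re,
    Complex.intCast_im, Complex.I_re, Complex.I_im, Complex.ofReal_re, Complex.ofReal_im,
    Complex.re_ofNat, Complex.im_ofNat] at him
  rw [abs_lt] at e3
  have hpi := Real.pi_pos
  have hn0 : n = 0 := by
    have hlt : (n : ℝ) < 1 := by nlinarith
    have hgt : (-1 : ℝ) < n := by nlinarith
    have hlt' : n < 1 := by exact_mod_cast hlt
    have hgt' : -1 < n := by exact_mod_cast hgt
    omega
  subst hn0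
  exact h3 ⟨⟨e1, e2⟩, by constructor <;> simp at him <;> linarith⟩

variable [CompleteSpace 𝔸]

theorem differentiableAt_expPullback_resolvent {w : ℂ} (hw : Complex.exp w ∉ spectrum ℂ T) :
    DifferentiableAt ℂ (expPullback (resolvent T)) w := by
  have h1 : HasDerivAt (resolvent T) _ (Complex.exp w) :=
    spectrum.hasDerivAt_resolvent_const_left (spectrum.notMem_iff.1 hw)
  exact Complex.differentiableAt_exp.smul
    (h1.differentiableAt.comp w Complex.differentiableAt_exp)

theorem eventually_norm_expPullback_resolvent_le (h0 : (0 : ℂ) ∉ spectrum ℂ T) {ε : ℝ} (hε : 0 < ε) :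
    ∀ᶠ M : ℝ in atTop, ∀ y : ℝ,
      ‖expPullback (resolvent T) (((-M : ℝ) : ℂ) + y * Complex.I)‖ ≤ ε := by
  have h1 : ContinuousAt (fun z => z • resolvent T z) (0 : ℂ) :=
    continuousAt_id.smul (spectrum.hasDerivAt_resolvent_const_left
      (spectrum.notMem_iff.1 h0)).continuousAt
  obtain ⟨δ, hδ, h2⟩ := Metric.continuousAt_iff.1 h1 ε hε
  have h3 : Tendsto (fun M : ℝ => Real.exp (-M)) atTop (𝓝 0) :=
    Real.tendsto_exp_atBot.comp tendsto_neg_atTop_atBot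
  filter_upwards [h3.eventually (gt_mem_nhds hδ)] with M hM y
  have h4 := h2 (x := Complex.exp (((-M : ℝ) : ℂ) + y * Complex.I))
    (by rw [dist_zero_right, Complex.norm_exp]; simpa using hM)
  simp only [zero_smul, dist_zero_right] at h4
  exact h4.le

theorem eventually_norm_expPullback_resolvent_sub_one_le (T : 𝔸) {ε : ℝ} (hε : 0 < ε) :
    ∀ᶠ M : ℝ in atTop, ∀ y : ℝ,
      ‖expPullback (resolvent T) ((M : ℂ) + y * Complex.I) - 1‖ ≤ ε := by
  have h1 : Tendsto (fun z => T * resolvent T z) (Bornology.cobounded ℂ) (𝓝 (T * 0)) :=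
    (spectrum.resolvent_tendsto_cobounded T).const_mul T
  rw [mul_zero] at h1
  have h2 : ∀ᶠ z in Bornology.cobounded ℂ, ‖z • resolvent T z - 1‖ ≤ ε := by
    have h3 : ∀ᶠ z in Bornology.cobounded ℂ, z ∉ spectrum ℂ T :=
      Bornology.isBounded_def.1 (spectrum.isBounded (𝕜 := ℂ) T)
    filter_upwards [h3, h1.eventually (Metric.closedBall_mem_nhds _ hε)] with z hz hz'
    have h4 := Ring.mul_inverse_cancel _ (spectrum.notMem_iff.1 hz)
    rw [sub_mul, Algebra.algebraMap_eq_smul_one, smul_mul_assoc, one_mul, sub_eq_iff_eq_add] at h4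
    rw [resolvent, Algebra.algebraMap_eq_smul_one, h4, add_sub_cancel_left]
    simpa [resolvent, Algebra.algebraMap_eq_smul_one] using hz'
  rw [(hasBasis_cobounded_norm).eventually_iff] at h2
  obtain ⟨C, -, hC⟩ := h2
  filter_upwards [Real.tendsto_exp_atTop.eventually_ge_atTop C] with M hM y
  exact hC (x := Complex.exp ((M : ℂ) + y * Complex.I)) (by
    rw [mem_ofPred_eq, Complex.norm_exp]; simpa using hM)

/-- The total residue of the resolvent inside a contour enclosing the spectrum. In the coordinate
`w = log z` the rectangle is enlarged to `[-M, M] × [-θ, 2π - θ]`: the horizontal sides cancel by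
periodicity, and `z (z - T)⁻¹` tends to `1` and `0` on the vertical sides as `M → ∞`. -/
theorem rectIntegral_resolvent (hR : 0 < R) (hθ : 0 < θ) (hθπ : θ < Real.pi)
    (hT : spectrum ℂ T ⊆ annularSector R θ) :
    rectIntegral (-R) R (-θ) θ (expPullback (resolvent T)) =
      (2 * Real.pi * Complex.I : ℂ) • (1 : 𝔸) := by
  set g := expPullback (resolvent T) with hg
  have hpi := Real.pi_pos
  have h0 : (0 : ℂ) ∉ spectrum ℂ T := fun h => by
    have h1 := (hT h).1
    rw [norm_zero] at h1
    exact absurd h1 (Real.exp_pos _).not_gt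
  have hd : ∀ w : ℂ, -θ ≤ w.im → w.im ≤ 2 * Real.pi - θ →
      ¬(w.re ∈ Ioo (-R) R ∧ w.im ∈ Ioo (-θ) θ) → DifferentiableAt ℂ g w := fun w h1 h2 h3 =>
    differentiableAt_expPullback_resolvent fun h => exp_notMem_annularSector hθπ h1 h2 h3 (hT h)
  set S : Set ℂ := {w | -θ ≤ w.im ∧ w.im ≤ 2 * Real.pi - θ ∧
    ¬(w.re ∈ Ioo (-R) R ∧ w.im ∈ Ioo (-θ) θ)}
  have hc : ContinuousOn g S := fun w hw =>
    (hd w hw.1 hw.2.1 hw.2.2).continuousAt.continuousWithinAt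
  have key : ∀ M, R ≤ M → rectIntegral (-R) R (-θ) θ g =
      Complex.I • (∫ y in (-θ)..(2 * Real.pi - θ), g (M + y * Complex.I)) -
      Complex.I • (∫ y in (-θ)..(2 * Real.pi - θ), g ((-M : ℝ) + y * Complex.I)) := by
    intro M hM
    have e1 : rectIntegral (-M) (-R) (-θ) θ g = 0 :=
      rectIntegral_eq_zero (by linarith) (by linarith) fun w h1 h2 =>
        hd w h2.1 (by linarith [h2.2]) fun h => absurd h.1.1 (not_lt.2 h1.2)
    have e2 : rectIntegral R M (-θ) θ g = 0 :=
      rectIntegral_eq_zero (by linarith) (by linarith) fun w h1 h2 =>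
        hd w h2.1 (by linarith [h2.2]) fun h => absurd h.1.2 (not_lt.2 h1.1)
    have e3 : rectIntegral (-M) M θ (2 * Real.pi - θ) g = 0 :=
      rectIntegral_eq_zero (by linarith) (by linarith) fun w h1 h2 =>
        hd w (by linarith [h2.1]) h2.2 fun h => absurd h.2.2 (not_lt.2 h2.1)
    -- the integrals over the sides of the large rectangle, cut at the corners of the small one
    have hor : ∀ m, m = -θ ∨ m = θ → (∫ x in (-M)..M, g (x + m * Complex.I)) =
        (∫ x in (-M)..(-R), g (x + m * Complex.I)) + (∫ x in (-R)..R, g (x + m * Complex.I)) +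
        ∫ x in R..M, g (x + m * Complex.I) := by
      intro m hm
      have hi : ∀ a b : ℝ, a ≤ b → IntervalIntegrable (fun x : ℝ => g (x + m * Complex.I))
          volume a b := fun a b hab =>
        intervalIntegrable_horizontal hc hab fun w _ h2 => by
          refine ⟨?_, ?_, fun h => ?_⟩
          · rcases hm with hm | hm <;> linarith
          · rcases hm with hm | hm <;> linarith
          · have := h.2.1; have := h.2.2
            rcases hm with hm | hm <;> linarith
      rw [intervalIntegral.integral_add_adjacent_intervals,
        intervalIntegral.integral_add_adjacent_intervals]
      · exact hi _ _ (by linarith)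
      · exact hi _ _ (by linarith)
      · exact hi _ _ (by linarith)
      · exact hi _ _ (by linarith)
    have ver : ∀ m : ℝ, m = -M ∨ m = M →
        (∫ y in (-θ)..(2 * Real.pi - θ), g (m + y * Complex.I)) =
        (∫ y in (-θ)..θ, g (m + y * Complex.I)) +
        ∫ y in θ..(2 * Real.pi - θ), g (m + y * Complex.I) := by
      intro m hm
      have hi : ∀ a b : ℝ, -θ ≤ a → b ≤ 2 * Real.pi - θ → a ≤ b →
          IntervalIntegrable (fun y : ℝ => g (m + y * Complex.I)) volume a b := fun a b ha hb hab =>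
        intervalIntegrable_vertical hc hab fun w h1 h2 => by
          refine ⟨by linarith [h2.1], by linarith [h2.2], fun h => ?_⟩
          have := h.1.1; have := h.1.2
          rcases hm with hm | hm <;> linarith
      rw [intervalIntegral.integral_add_adjacent_intervals]
      · exact hi _ _ (by linarith) (by linarith) (by linarith)
      · exact hi _ _ (by linarith) (by linarith) (by linarith)
    have per : (∫ x in (-M)..M, g (x + (2 * Real.pi - θ : ℝ) * Complex.I)) =
        ∫ x in (-M)..M, g (x + (-θ : ℝ) * Complex.I) := by
      refine intervalIntegral.integral_congr fun x _ => ?_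
      have : Complex.exp (x + (2 * Real.pi - θ : ℝ) * Complex.I) =
          Complex.exp (x + (-θ : ℝ) * Complex.I) :=
        Complex.exp_eq_exp_iff_exists_int.2 ⟨1, by push_cast; ring⟩
      simp only [hg, expPullback, this]
    have v1 := ver (-M) (Or.inl rfl)
    have v2 := ver M (Or.inr rfl)
    have b1 := hor (-θ) (Or.inl rfl)
    have b2 := hor θ (Or.inr rfl)
    have e : rectIntegral (-R) R (-θ) θ g = rectIntegral (-R) R (-θ) θ g +
        rectIntegral (-M) (-R) (-θ) θ g + rectIntegral R M (-θ) θ g +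
        rectIntegral (-M) M θ (2 * Real.pi - θ) g := by
      rw [e1, e2, e3]; simp only [add_zero]
    rw [e, v1, v2]
    unfold rectIntegral
    rw [per, b1, b2]
    simp only [smul_add]
    abel
  -- the integral differs from `2πi` by arbitrarily little
  rw [← sub_eq_zero, ← norm_le_zero_iff]
  refine le_of_forall_pos_le_add fun ε hε => ?_
  have hε' : 0 < ε / (4 * Real.pi) := by positivity
  obtain ⟨M, hM, ha, hb⟩ := ((eventually_ge_atTop R).and
    ((eventually_norm_expPullback_resolvent_le h0 hε').and
      (eventually_norm_expPullback_resolvent_sub_one_le T hε'))).exists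
  have hint : IntervalIntegrable (fun y : ℝ => g (M + y * Complex.I)) volume (-θ)
      (2 * Real.pi - θ) :=
    intervalIntegrable_vertical hc (by linarith) fun w h1 h2 =>
      ⟨h2.1, h2.2, fun h => by linarith [h.1.2]⟩
  have e : rectIntegral (-R) R (-θ) θ g - (2 * Real.pi * Complex.I : ℂ) • (1 : 𝔸) =
      Complex.I • (∫ y in (-θ)..(2 * Real.pi - θ), (g (M + y * Complex.I) - 1)) -
      Complex.I • (∫ y in (-θ)..(2 * Real.pi - θ), g ((-M : ℝ) + y * Complex.I)) := by
    rw [key M hM, intervalIntegral.integral_sub hint intervalIntegrable_const,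
      intervalIntegral.integral_const, smul_sub, ← Complex.coe_smul, smul_smul]
    have : (2 * Real.pi * Complex.I : ℂ) = Complex.I * ((2 * Real.pi - θ - -θ : ℝ) : ℂ) := by
      push_cast; ring
    rw [this]
    abel
  have n1 := intervalIntegral.norm_integral_le_of_norm_le_const (a := -θ) (b := 2 * Real.pi - θ)
    (f := fun y : ℝ => g (M + y * Complex.I) - 1) fun y _ => hb y
  have n2 := intervalIntegral.norm_integral_le_of_norm_le_const (a := -θ) (b := 2 * Real.pi - θ)
    (f := fun y : ℝ => g ((-M : ℝ) + y * Complex.I)) fun y _ => ha y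
  have hl : |2 * Real.pi - θ - -θ| = 2 * Real.pi := by
    rw [show 2 * Real.pi - θ - -θ = 2 * Real.pi by ring, abs_of_pos (by positivity)]
  rw [hl, show ε / (4 * Real.pi) * (2 * Real.pi) = ε / 2 by field_simp; norm_num] at n1 n2
  rw [e]
  refine (norm_sub_le _ _).trans ?_
  rw [norm_smul, norm_smul, Complex.norm_I]
  linarith

end Contour

/-! ### Independence of the contour -/

section LogContour

variable {𝔸 : Type*} [NormedRing 𝔸] [NormedAlgebra ℂ 𝔸] {T : 𝔸}

theorem segmentPath_algebraMap (z : ℂ) (u : ℝ) :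
    segmentPath (algebraMap ℂ 𝔸 z) u = algebraMap ℂ 𝔸 (1 + u * (z - 1)) := by
  rw [segmentPath, map_add, map_one, map_mul, map_sub, map_one, Algebra.smul_def]

theorem one_add_mul_ne_zero {z : ℂ} (hz : z ∈ Complex.slitPlane) {u : ℝ}
    (hu : u ∈ Icc (0 : ℝ) 1) : 1 + (u : ℂ) * (z - 1) ≠ 0 := by
  have h := Complex.starConvex_one_slitPlane.add_smul_mem (y := z - 1) (by simpa using hz) hu.1 hu.2
  rw [Complex.real_smul] at h
  exact Complex.slitPlane_ne_zero h

theorem inverse_segmentPath_algebraMap {z : ℂ} (hz : z ∈ Complex.slitPlane) {u : ℝ}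
    (hu : u ∈ Icc (0 : ℝ) 1) :
    Ring.inverse (segmentPath (algebraMap ℂ 𝔸 z) u) = (1 + u * (z - 1))⁻¹ • (1 : 𝔸) := by
  have h0 := one_add_mul_ne_zero hz hu
  have h1 : IsUnit (segmentPath (algebraMap ℂ 𝔸 z) u) := by
    rw [segmentPath_algebraMap]; exact (isUnit_iff_ne_zero.2 h0).map _
  rw [← mul_one (Ring.inverse _), ← Algebra.algebraMap_eq_smul_one]
  have h2 : (1 : 𝔸) = segmentPath (algebraMap ℂ 𝔸 z) u *
      algebraMap ℂ 𝔸 (1 + u * (z - 1))⁻¹ := by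
    rw [segmentPath_algebraMap, ← map_mul, mul_inv_cancel₀ h0, map_one]
  conv_lhs => rw [h2]
  rw [← mul_assoc, Ring.inverse_mul_cancel _ h1, one_mul]

theorem segmentUnits_algebraMap {z : ℂ} (hz : z ∈ Complex.slitPlane) :
    SegmentUnits (algebraMap ℂ 𝔸 z) := fun u hu => by
  rw [segmentPath_algebraMap]
  exact (isUnit_iff_ne_zero.2 (one_add_mul_ne_zero hz hu)).map _

/-- The point `1 + u (T - 1)` is a nonzero multiple of `(u - 1) / u - T` for `0 < u ≤ 1`, and
`(u - 1) / u` ranges over `(-∞, 0]`. -/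
theorem segmentUnits_iff : SegmentUnits T ↔ spectrum ℂ T ⊆ Complex.slitPlane := by
  constructor
  · intro h z hz
    by_contra hz'
    rw [Complex.mem_slitPlane_iff_not_le_zero, not_not] at hz'
    obtain ⟨r, hr, rfl⟩ : ∃ r : ℝ, r ≤ 0 ∧ z = (r : ℂ) :=
      ⟨z.re, (Complex.le_def.1 hz').1, Complex.ext rfl (Complex.le_def.1 hz').2⟩
    have hpos : 0 < 1 - r := by linarith
    have hne : (1 - r : ℂ) ≠ 0 := by exact_mod_cast hpos.ne'
    have h1 := h (1 / (1 - r)) ⟨by positivity, by rw [div_le_one hpos]; linarith⟩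
    refine hz (show IsUnit _ from ?_)
    have h2 : algebraMap ℂ 𝔸 r - T =
        algebraMap ℂ 𝔸 (-(1 - r)) * segmentPath T (1 / (1 - r)) := by
      rw [segmentPath, Algebra.algebraMap_eq_smul_one, Algebra.algebraMap_eq_smul_one,
        smul_mul_assoc, one_mul, smul_add, smul_smul]
      have : (-(1 - r : ℂ)) * ((1 / (1 - r) : ℝ) : ℂ) = -1 := by
        push_cast; field_simp
      rw [this]
      module
    rw [h2]
    exact ((isUnit_iff_ne_zero.2 (neg_ne_zero.2 hne)).map _).mul h1
  · intro h u hu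
    rcases hu.1.eq_or_lt with rfl | hu0
    · simp [segmentPath]
    · have hr : (((u - 1) / u : ℝ) : ℂ) ∉ spectrum ℂ T := fun h' => by
        have := (Complex.ofReal_mem_slitPlane).1 (h h')
        exact absurd this (not_lt.2 (div_nonpos_of_nonpos_of_nonneg (by linarith [hu.2]) hu.1))
      have hu0' : (u : ℂ) ≠ 0 := by exact_mod_cast hu0.ne'
      have h2 : segmentPath T u =
          algebraMap ℂ 𝔸 (-u) * (algebraMap ℂ 𝔸 (((u - 1) / u : ℝ) : ℂ) - T) := by
        rw [segmentPath, Algebra.algebraMap_eq_smul_one, Algebra.algebraMap_eq_smul_one,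
          smul_mul_assoc, one_mul, smul_sub (-u : ℂ), smul_smul]
        have : (-u : ℂ) * (((u - 1) / u : ℝ) : ℂ) = 1 - u := by
          push_cast; field_simp; ring
        rw [this]
        module
      rw [h2]
      exact ((isUnit_iff_ne_zero.2 (neg_ne_zero.2 hu0')).map _).mul (spectrum.notMem_iff.1 hr)

theorem annularSector_subset_slitPlane {R θ : ℝ} (hθπ : θ < Real.pi) :
    annularSector R θ ⊆ Complex.slitPlane := by
  rintro z ⟨h1, -, h3⟩
  rw [Complex.mem_slitPlane_iff_arg]
  refine ⟨fun h => ?_, fun h => ?_⟩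
  · rw [h, abs_of_pos Real.pi_pos] at h3; linarith
  · rw [h, norm_zero] at h1; exact absurd h1 (Real.exp_pos _).not_gt

variable [CompleteSpace 𝔸]

/-- The correction term `∫₀¹ (1 + u (z - 1))⁻¹ (1 + u (T - 1))⁻¹ du`, which equals
`(log z - log T) (z - T)⁻¹` off the spectrum of `T` but is holomorphic in the whole slit plane. -/
noncomputable def logQuotient (T : 𝔸) (z : ℂ) : 𝔸 :=
  ∫ u in (0 : ℝ)..1, Ring.inverse (segmentPath (algebraMap ℂ 𝔸 z) u) *
    Ring.inverse (segmentPath T u)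

theorem SegmentUnits.differentiableAt_logQuotient (h : SegmentUnits T) {z : ℂ}
    (hz : z ∈ Complex.slitPlane) : DifferentiableAt ℂ (logQuotient T) z := by
  have h1 := (segmentUnits_algebraMap (𝔸 := 𝔸) hz).analyticAt_integral h.continuousOn
  exact (h1.comp (f := algebraMap ℂ 𝔸) ((algebraMapCLM ℂ 𝔸).analyticAt z)).differentiableAt

/-- Integrated form of the identity
`(z - 1) / p - (T - 1) P⁻¹ = p⁻¹ (z - T) P⁻¹` with `p = 1 + u (z - 1)` and `P = 1 + u (T - 1)`. -/
theorem SegmentUnits.log_smul_resolvent (h : SegmentUnits T) {z : ℂ}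
    (hz : z ∈ Complex.slitPlane) (hzT : z ∉ spectrum ℂ T) :
    Complex.log z • resolvent T z = segmentLog T * resolvent T z + logQuotient T z := by
  have hcp : ContinuousOn (fun u : ℝ => (1 + u * (z - 1))⁻¹ * (z - 1)) (Icc 0 1) :=
    (ContinuousOn.inv₀ (by fun_prop) fun u hu => one_add_mul_ne_zero hz hu).mul continuousOn_const
  have hlog : Complex.log z = ∫ u in (0 : ℝ)..1, (1 + u * (z - 1))⁻¹ * (z - 1) := by
    have := Complex.log_eq_integral (z := z - 1) (by simpa using hz)
    rw [add_sub_cancel] at this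
    rw [this, intervalIntegral.integral_mul_const, mul_comm]
    simp only [Complex.real_smul]
  have hseg : segmentLog T * resolvent T z =
      ∫ u in (0 : ℝ)..1, (T - 1) * Ring.inverse (segmentPath T u) * resolvent T z := by
    have hi : IntervalIntegrable (fun u => Ring.inverse (segmentPath T u)) volume 0 1 :=
      ContinuousOn.intervalIntegrable_of_Icc zero_le_one h.continuousOn
    have := (ContinuousLinearMap.mulLeftRight ℂ 𝔸 (T - 1)
      (resolvent T z)).intervalIntegral_comp_comm hi
    simp only [ContinuousLinearMap.mulLeftRight_apply] at this
    rw [segmentLog, segmentPrimitive, this]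
  rw [hlog, ← intervalIntegral.integral_smul_const, hseg, logQuotient,
    ← intervalIntegral.integral_add]
  · refine intervalIntegral.integral_congr fun u hu => ?_
    rw [uIcc_of_le zero_le_one] at hu
    simp only [inverse_segmentPath_algebraMap hz hu]
    set P := Ring.inverse (segmentPath T u) with hP
    set p : ℂ := 1 + u * (z - 1) with hp
    have hp0 : p ≠ 0 := one_add_mul_ne_zero hz hu
    have hRz : (z • (1 : 𝔸) - T) * resolvent T z = 1 := by
      rw [← Algebra.algebraMap_eq_smul_one]
      exact Ring.mul_inverse_cancel _ (spectrum.notMem_iff.1 hzT)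
    have hPP : segmentPath T u * P = 1 := Ring.mul_inverse_cancel _ (h u hu)
    have hcomm : Commute (resolvent T z) P := by
      refine commute_inverse (commute_segmentPath (Commute.symm ?_) u)
      exact commute_inverse (Commute.sub_right (Algebra.commutes z T).symm (Commute.refl T))
    have h1 : (z - 1) • segmentPath T u - p • (T - 1) = z • (1 : 𝔸) - T := by
      rw [segmentPath, hp]; module
    have h2 : ((z - 1) • (1 : 𝔸) - p • ((T - 1) * P)) * resolvent T z = P := by
      have : (z - 1) • (1 : 𝔸) - p • ((T - 1) * P) = (z • (1 : 𝔸) - T) * P := by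
        rw [← h1, sub_mul (_ • _), smul_mul_assoc, smul_mul_assoc, hPP]
      rw [this, mul_assoc, ← hcomm.eq, ← mul_assoc, hRz, one_mul]
    have h3 := congrArg (fun x => p⁻¹ • x) h2
    rw [sub_mul, smul_sub, smul_mul_assoc, smul_mul_assoc, one_mul, smul_smul, smul_smul,
      inv_mul_cancel₀ hp0, one_smul] at h3
    rw [smul_mul_assoc, one_mul, ← h3, add_sub_cancel]
  · exact ContinuousOn.intervalIntegrable_of_Icc zero_le_one
      ((continuousOn_const.mul h.continuousOn).mul continuousOn_const)
  · exact ContinuousOn.intervalIntegrable_of_Icc zero_le_one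
      ((segmentUnits_algebraMap hz).continuousOn.mul h.continuousOn)

/-- The contour integral for the principal logarithm does not depend on the contour. -/
theorem sectorContourIntegral_log {R θ : ℝ} (hR : 0 < R) (hθ : 0 < θ) (hθπ : θ < Real.pi)
    (hT : spectrum ℂ T ⊆ annularSector R θ) :
    (2 * Real.pi * Complex.I : ℂ)⁻¹ •
      sectorContourIntegral R θ (fun z => Complex.log z • resolvent T z) = segmentLog T := by
  have hS : SegmentUnits T := segmentUnits_iff.2 (hT.trans (annularSector_subset_slitPlane hθπ))
  have hR' : -R ≤ R := by linarith
  have hθ' : -θ ≤ θ := by linarith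
  have hslit : ∀ w : ℂ, w.im ∈ Icc (-θ) θ → Complex.exp w ∈ Complex.slitPlane := by
    intro w hw
    rw [Complex.mem_slitPlane_iff_arg]
    refine ⟨?_, Complex.exp_ne_zero w⟩
    rw [← Complex.log_im, Complex.log_exp (by linarith [hw.1]) (by linarith [hw.2])]
    linarith [hw.2]
  have hspec : ∀ w ∈ rectBoundary (-R) R (-θ) θ, Complex.exp w ∉ spectrum ℂ T := fun w hw h =>
    exp_notMem_annularSector hθπ hw.2.1.1 (by linarith [hw.2.1.2]) hw.2.2 (hT h)
  have hres : ∀ w ∈ rectBoundary (-R) R (-θ) θ, DifferentiableAt ℂ (resolvent T)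
      (Complex.exp w) := fun w hw =>
    (spectrum.hasDerivAt_resolvent_const_left
      (spectrum.notMem_iff.1 (hspec w hw))).differentiableAt
  rw [sectorContourIntegral_eq R θ hR.le hθ.le (f := fun z => Complex.log z • resolvent T z)
    fun w hw => (continuousAt_clog (hslit w hw.2.1)).smul (hres w hw).continuousAt]
  have hc1 : ContinuousOn (expPullback (resolvent T)) (rectBoundary (-R) R (-θ) θ) :=
    fun w hw => (differentiableAt_expPullback_resolvent
      (hspec w hw)).continuousAt.continuousWithinAt
  have hd : ∀ w : ℂ, w.im ∈ Icc (-θ) θ → DifferentiableAt ℂ (expPullback (logQuotient T)) w :=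
    fun w hw => Complex.differentiableAt_exp.smul
      ((hS.differentiableAt_logQuotient (hslit w hw)).comp w Complex.differentiableAt_exp)
  have hc2 : ContinuousOn (expPullback (logQuotient T)) (rectBoundary (-R) R (-θ) θ) :=
    fun w hw => (hd w hw.2.1).continuousAt.continuousWithinAt
  have h1 : rectIntegral (-R) R (-θ) θ (expPullback fun z => Complex.log z • resolvent T z) =
      rectIntegral (-R) R (-θ) θ (fun w =>
        ContinuousLinearMap.mul ℂ 𝔸 (segmentLog T) (expPullback (resolvent T) w) +
          expPullback (logQuotient T) w) := by
    refine rectIntegral_congr hR' hθ' fun w hw => ?_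
    simp only [expPullback, hS.log_smul_resolvent (hslit w hw.2.1) (hspec w hw), smul_add,
      ContinuousLinearMap.mul_apply', mul_smul_comm]
  rw [h1, rectIntegral_add hR' hθ'
    (h := fun w => ContinuousLinearMap.mul ℂ 𝔸 (segmentLog T) (expPullback (resolvent T) w))
    ((ContinuousLinearMap.continuous _).comp_continuousOn hc1) hc2,
    rectIntegral_clm hR' hθ' hc1, rectIntegral_resolvent hR hθ hθπ hT,
    rectIntegral_eq_zero hR' hθ' fun w _ hw => hd w hw]
  rw [add_zero, ContinuousLinearMap.mul_apply', mul_smul_comm, mul_one, smul_smul,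
    inv_mul_cancel₀ Complex.two_pi_I_ne_zero, one_smul]

end LogContour

section Operators

variable {H : Type*} [NormedAddCommGroup H] [InnerProductSpace ℂ H] [CompleteSpace H]
  {T : H →L[ℂ] H}

/-- On the compact spectrum, contained in the slit plane, `|arg z|` and `|log |z||` are continuous and
attain their maxima, the first of which is less than `π`. -/
theorem SegmentUnits.logDefined (h : SegmentUnits T) : LogDefined T := by
  have hsub := segmentUnits_iff.1 h
  rcases (spectrum ℂ T).eq_empty_or_nonempty with he | hne
  · exact ⟨(1, 1), one_pos, one_pos, by linarith [Real.pi_gt_three], by simp [he]⟩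
  have hK := spectrum.isCompact (𝕜 := ℂ) T
  obtain ⟨z1, hz1, h1⟩ := hK.exists_isMaxOn hne
    (f := fun z => |z.arg|) fun z hz =>
      (Complex.continuousAt_arg (hsub hz)).abs.continuousWithinAt
  obtain ⟨z2, hz2, h2⟩ := hK.exists_isMaxOn hne
    (f := fun z => |Real.log ‖z‖|) fun z hz =>
      ((Real.continuousAt_log (norm_ne_zero_iff.2 (Complex.slitPlane_ne_zero (hsub hz)))).comp
        continuous_norm.continuousAt).abs.continuousWithinAt
  have hlt : |z1.arg| < Real.pi :=
    lt_of_le_of_ne (Complex.abs_arg_le_pi z1) fun he => by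
      rcases (abs_eq Real.pi_pos.le).1 he with h' | h'
      · exact (Complex.mem_slitPlane_iff_arg.1 (hsub hz1)).1 h'
      · exact (Complex.neg_pi_lt_arg z1).ne' h'
  refine ⟨(|Real.log ‖z2‖| + 1, (|z1.arg| + Real.pi) / 2), by positivity,
    by positivity, by change (_ + _) / 2 < _; linarith, fun z hz => ?_⟩
  have hz0 : 0 < ‖z‖ := norm_pos_iff.2 (Complex.slitPlane_ne_zero (hsub hz))
  have a1 : |z.arg| ≤ |z1.arg| := h1 hz
  have a2 : |Real.log ‖z‖| ≤ |Real.log ‖z2‖| := h2 hz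
  have a3 := abs_le.1 a2
  refine ⟨?_, ?_, ?_⟩
  · rw [← Real.lt_log_iff_exp_lt hz0]; change -(_ + 1) < _; linarith
  · rw [← Real.log_lt_iff_lt_exp hz0]; change _ < _ + 1; linarith
  · change _ < (_ + _) / 2; linarith

theorem LogDefined.opLog_eq (h : LogDefined T) : opLog T = segmentLog T := by
  rw [opLog, dif_pos h]
  obtain ⟨hR, hθ, hθπ, hT⟩ := h.choose_spec
  exact sectorContourIntegral_log hR hθ hθπ hT

end Operators

/-! ### The Dyson series -/

section Increments

/-- A comparison principle for continuous functions: if locally to the right the increments of `f`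
are at most those of `g`, then `f ≤ g`. -/
theorem le_of_eventually_sub_le_sub {f g : ℝ → ℝ} {t : ℝ} (hf : ContinuousOn f (Icc 0 t))
    (hg : ContinuousOn g (Icc 0 t)) (h0 : f 0 ≤ g 0)
    (h : ∀ s ∈ Ico 0 t, ∀ᶠ s' in 𝓝[>] s, s' ≤ t → f s' - f s ≤ g s' - g s) :
    ∀ s ∈ Icc 0 t, f s ≤ g s := by
  have hcl : IsClosed ({s | f s ≤ g s} ∩ Icc 0 t) := by
    have := (hf.sub hg).preimage_isClosed_of_isClosed isClosed_Icc isClosed_Iic (t := Iic 0)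
    convert this using 1
    ext s
    simp [and_comm]
  refine hcl.Icc_subset_of_forall_mem_nhdsWithin h0 fun s hs => ?_
  filter_upwards [h s hs.2, Ioo_mem_nhdsGT hs.2.2] with s' h1 h2
  have h3 : f s ≤ g s := hs.1
  have h4 := h1 h2.2.le
  change f s' ≤ g s'
  linarith

variable {a : ℝ → ℝ} {t : ℝ}

theorem continuousOn_integral (ha : IntervalIntegrable a volume 0 t) (ht : 0 ≤ t) :
    ContinuousOn (fun s => ∫ r in (0 : ℝ)..s, a r) (Icc 0 t) := by
  have := intervalIntegral.continuousOn_primitive_interval' ha left_mem_uIcc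
  rwa [uIcc_of_le ht] at this

theorem tendsto_increment {m : ℝ → ℝ} (hm : ContinuousOn m (Icc 0 t)) {s : ℝ}
    (hs : s ∈ Ico 0 t) : Tendsto (fun s' => m s' - m s) (𝓝[>] s) (𝓝 0) := by
  have h1 : Tendsto m (𝓝[>] s) (𝓝 (m s)) :=
    (hm s (Ico_subset_Icc_self hs)).mono_left
      ((nhdsWithin_le_of_mem (mem_of_superset (Ioo_mem_nhdsGT hs.2) fun x hx =>
        ⟨hs.1.trans hx.1.le, hx.2.le⟩)))
  simpa using h1.sub_const (m s)

theorem intervalIntegrable_sub (ha : IntervalIntegrable a volume 0 t) {s s' : ℝ}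
    (hs : 0 ≤ s) (hs' : s ≤ s') (hst : s' ≤ t) : IntervalIntegrable a volume s s' :=
  ha.mono_set (by
    rw [uIcc_of_le hs', uIcc_of_le (hs.trans (hs'.trans hst))]; exact Icc_subset_Icc hs hst)

/-- For `m(s) = ∫₀ˢ a`, the bound `∫₀ˢ a e^{K m} ≤ (2 / K) e^{K m(s)}`. The factor `2` makes up for
comparing only increments with `K (m(s') - m(s)) ≤ 1`, so that no derivative of `m` is needed. -/
theorem integral_mul_exp_le (ha : IntervalIntegrable a volume 0 t) (ha0 : ∀ s, 0 ≤ a s)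
    {K : ℝ} (hK : 0 < K) {s : ℝ} (hs : s ∈ Icc 0 t) :
    ∫ r in (0 : ℝ)..s, a r * Real.exp (K * ∫ x in (0 : ℝ)..r, a x) ≤
      2 / K * Real.exp (K * ∫ x in (0 : ℝ)..s, a x) := by
  have ht : 0 ≤ t := hs.1.trans hs.2
  set m : ℝ → ℝ := fun s => ∫ x in (0 : ℝ)..s, a x
  have hm : ContinuousOn m (Icc 0 t) := continuousOn_integral ha ht
  have hE : ContinuousOn (fun s => Real.exp (K * m s)) (Icc 0 t) := by fun_prop
  have hi : IntervalIntegrable (fun r => a r * Real.exp (K * m r)) volume 0 t :=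
    ha.mul_continuousOn (by rwa [uIcc_of_le ht])
  have hsub : ∀ {s s' : ℝ}, 0 ≤ s → s ≤ s' → s' ≤ t → m s' - m s = ∫ x in s..s', a x := by
    intro s s' h1 h2 h3
    exact intervalIntegral.integral_interval_sub_left
      (intervalIntegrable_sub ha le_rfl (h1.trans h2) h3)
      (intervalIntegrable_sub ha le_rfl h1 (h2.trans h3))
  have hmono : ∀ {s s' : ℝ}, 0 ≤ s → s ≤ s' → s' ≤ t → m s ≤ m s' := fun h1 h2 h3 =>
    sub_nonneg.1 (hsub h1 h2 h3 ▸ intervalIntegral.integral_nonneg h2 fun x _ => ha0 x)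
  have key := le_of_eventually_sub_le_sub (f := fun s => ∫ r in (0 : ℝ)..s, a r * Real.exp (K * m r))
    (g := fun s => 2 / K * Real.exp (K * m s)) (continuousOn_integral hi ht)
    (continuousOn_const.mul hE) (by simp; positivity) ?_ s hs
  · exact key
  intro s hs
  filter_upwards [(tendsto_increment hm hs).eventually (gt_mem_nhds (show 0 < 1 / K by positivity)),
    self_mem_nhdsWithin] with s' h1 h2 h3
  have h2 : s ≤ s' := le_of_lt h2
  rw [intervalIntegral.integral_interval_sub_left
    (intervalIntegrable_sub hi le_rfl (hs.1.trans h2) h3)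
    (intervalIntegrable_sub hi le_rfl hs.1 (h2.trans h3))]
  have e1 : ∫ r in s..s', a r * Real.exp (K * m r) ≤ (m s' - m s) * Real.exp (K * m s') := by
    rw [hsub hs.1 h2 h3, ← intervalIntegral.integral_mul_const]
    refine intervalIntegral.integral_mono_on h2 (intervalIntegrable_sub hi hs.1 h2 h3)
      ((intervalIntegrable_sub ha hs.1 h2 h3).mul_const _) fun r hr => ?_
    exact mul_le_mul_of_nonneg_left (Real.exp_le_exp.2 (mul_le_mul_of_nonneg_left
      (hmono (hs.1.trans hr.1) hr.2 h3) hK.le)) (ha0 r)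
  refine e1.trans ?_
  set δ := m s' - m s with hδ
  have hδ0 : 0 ≤ δ := sub_nonneg.2 (hmono hs.1 h2 h3)
  have hKδ : K * δ < 1 := by rwa [lt_div_iff₀ hK, mul_comm] at h1
  have hx : 0 ≤ K * δ := by positivity
  have e2 : Real.exp (K * m s) = Real.exp (K * m s') * Real.exp (-(K * δ)) := by
    rw [← Real.exp_add, hδ]; ring_nf
  have e3 : Real.exp (-(K * δ)) ≤ 1 - K * δ / 2 := by
    rw [Real.exp_neg, inv_le_comm₀ (Real.exp_pos _) (by linarith)]
    refine le_trans ?_ (Real.add_one_le_exp _)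
    rw [inv_le_iff_one_le_mul₀ (by linarith)]
    nlinarith
  rw [e2]
  have hp := Real.exp_pos (K * m s')
  have e4 : 2 / K * (Real.exp (K * m s') * (K * δ / 2)) = δ * Real.exp (K * m s') := by
    field_simp
  rw [← e4, ← mul_sub]
  refine mul_le_mul_of_nonneg_left ?_ (by positivity)
  nlinarith

end Increments

section Entire

variable {𝔸 : Type*} [NormedRing 𝔸] {A : ℝ → 𝔸} {t : ℝ}

theorem intervalIntegrable_mul (hA : IntervalIntegrable A volume 0 t) (ht : 0 ≤ t) {F : ℝ → 𝔸}
    (hF : ContinuousOn F (Icc 0 t)) : IntervalIntegrable (fun r => A r * F r) volume 0 t :=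
  hA.mul_continuousOn (by rwa [uIcc_of_le ht])

variable [NormedAlgebra ℂ 𝔸]

/-- In the norm with weight `e^{-K ∫ ‖A‖}` the Volterra operator `F ↦ ∫₀ˢ A F` has norm at most
`2 / K`. -/
theorem norm_integral_mul_le (hA : IntervalIntegrable A volume 0 t) {F : ℝ → 𝔸}
    {C K : ℝ} (hK : 0 < K) (hC : 0 ≤ C)
    (h : ∀ s ∈ Icc 0 t, ‖F s‖ ≤ C * Real.exp (K * ∫ x in (0 : ℝ)..s, ‖A x‖)) {s : ℝ}
    (hs : s ∈ Icc 0 t) :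
    ‖∫ r in (0 : ℝ)..s, A r * F r‖ ≤
      C * (2 / K) * Real.exp (K * ∫ x in (0 : ℝ)..s, ‖A x‖) := by
  have ht : 0 ≤ t := hs.1.trans hs.2
  have hE : ContinuousOn (fun s => Real.exp (K * ∫ x in (0 : ℝ)..s, ‖A x‖)) (Icc 0 t) :=
    Real.continuous_exp.comp_continuousOn
      (continuousOn_const.mul (continuousOn_integral hA.norm ht))
  have hi := intervalIntegrable_sub (hA.norm.mul_continuousOn (by rwa [uIcc_of_le ht]))
    le_rfl hs.1 hs.2
  calc ‖∫ r in (0 : ℝ)..s, A r * F r‖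
      ≤ ∫ r in (0 : ℝ)..s, C * (‖A r‖ * Real.exp (K * ∫ x in (0 : ℝ)..r, ‖A x‖)) := by
        refine intervalIntegral.norm_integral_le_of_norm_le hs.1 (ae_of_all _ fun r hr => ?_)
          (hi.const_mul C)
        refine (norm_mul_le _ _).trans ?_
        rw [mul_left_comm]
        exact mul_le_mul_of_nonneg_left (h r ⟨hr.1.le, hr.2.trans hs.2⟩) (norm_nonneg _)
    _ ≤ _ := by
        rw [intervalIntegral.integral_const_mul, mul_assoc]
        exact mul_le_mul_of_nonneg_left
          (integral_mul_exp_le hA.norm (fun _ => norm_nonneg _) hK hs) hC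

/-- The coefficients of the Dyson series: the iterated integrals
`D₀ = 1`, `Dₙ₊₁(s) = ∫₀ˢ A(r) Dₙ(r) dr`. -/
noncomputable def dysonCoeff (A : ℝ → 𝔸) : ℕ → ℝ → 𝔸
  | 0 => fun _ => 1
  | n + 1 => fun s => ∫ r in (0 : ℝ)..s, A r * dysonCoeff A n r

theorem continuousOn_dysonCoeff (hA : IntervalIntegrable A volume 0 t) (ht : 0 ≤ t) (n : ℕ) :
    ContinuousOn (dysonCoeff A n) (Icc 0 t) := by
  induction n with
  | zero => exact continuousOn_const
  | succ n ih =>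
    have := intervalIntegral.continuousOn_primitive_interval' (intervalIntegrable_mul hA ht ih)
      left_mem_uIcc
    rwa [uIcc_of_le ht] at this

theorem norm_dysonCoeff_le (hA : IntervalIntegrable A volume 0 t) {K : ℝ} (hK : 0 < K) (n : ℕ) :
    ∀ s ∈ Icc 0 t, ‖dysonCoeff A n s‖ ≤
      ‖(1 : 𝔸)‖ * (2 / K) ^ n * Real.exp (K * ∫ x in (0 : ℝ)..s, ‖A x‖) := by
  induction n with
  | zero =>
    intro s hs
    rw [pow_zero, mul_one]
    refine le_mul_of_one_le_right (norm_nonneg _) (Real.one_le_exp ?_)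
    exact mul_nonneg hK.le (intervalIntegral.integral_nonneg hs.1 fun _ _ => norm_nonneg _)
  | succ n ih =>
    intro s hs
    rw [pow_succ, ← mul_assoc]
    exact norm_integral_mul_le hA hK (by positivity) ih hs

variable [CompleteSpace 𝔸]

/-- A continuous solution of the integral equation is the sum of its Dyson series: the
remainders `Y - ∑_{k<n} εᵏ Dₖ` are obtained from `Y` by iterating `F ↦ ε ∫ A F`, a contraction for
the norm with weight `e^{-K ∫ ‖A‖}`, `K > 2 |ε|`. -/
theorem hasSum_dysonCoeff (hA : IntervalIntegrable A volume 0 t) {ε : ℂ} {Y : ℝ → 𝔸}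
    (hY : ContinuousOn Y (Icc 0 t))
    (hYe : ∀ s ∈ Icc 0 t, Y s = 1 + ε • ∫ r in (0 : ℝ)..s, A r * Y r) {s : ℝ}
    (hs : s ∈ Icc 0 t) : HasSum (fun n => ε ^ n • dysonCoeff A n s) (Y s) := by
  have ht : 0 ≤ t := hs.1.trans hs.2
  obtain ⟨K, hK, hKε⟩ : ∃ K : ℝ, 0 < K ∧ ‖ε‖ * (2 / K) < 1 := by
    refine ⟨2 * ‖ε‖ + 2, by positivity, ?_⟩
    rw [mul_div_assoc', div_lt_one (by positivity)]; linarith [norm_nonneg ε]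
  set E : ℝ → ℝ := fun s => Real.exp (K * ∫ x in (0 : ℝ)..s, ‖A x‖)
  have hq0 : 0 ≤ ‖ε‖ * (2 / K) := by positivity
  obtain ⟨C, hC⟩ := isCompact_Icc.exists_bound_of_continuousOn hY
  have hC0 : 0 ≤ C := (norm_nonneg _).trans (hC s hs)
  have hE1 : ∀ s ∈ Icc 0 t, 1 ≤ E s := fun s hs => Real.one_le_exp
    (mul_nonneg hK.le (intervalIntegral.integral_nonneg hs.1 fun _ _ => norm_nonneg _))
  set P : ℕ → ℝ → 𝔸 := fun n s => ∑ k ∈ Finset.range n, ε ^ k • dysonCoeff A k s with hP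
  have hPc : ∀ n, ContinuousOn (P n) (Icc 0 t) := fun n =>
    continuousOn_finsetSum _ fun k _ => (continuousOn_dysonCoeff hA ht k).const_smul _
  have hint : ∀ {F : ℝ → 𝔸}, ContinuousOn F (Icc 0 t) → ∀ s ∈ Icc 0 t,
      IntervalIntegrable (fun r => A r * F r) volume 0 s := fun hF s hs =>
    (intervalIntegrable_mul hA ht hF).mono_set (by
      rw [uIcc_of_le hs.1, uIcc_of_le ht]; exact Icc_subset_Icc_right hs.2)
  have hPs : ∀ n, ∀ s ∈ Icc 0 t, P (n + 1) s = 1 + ε • ∫ r in (0 : ℝ)..s, A r * P n r := by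
    intro n s hs
    simp only [hP]
    rw [Finset.sum_range_succ', pow_zero, one_smul, add_comm]
    congr 1
    simp only [Finset.mul_sum, mul_smul_comm]
    rw [intervalIntegral.integral_finsetSum fun k _ =>
      show IntervalIntegrable (fun r => ε ^ k • (A r * dysonCoeff A k r)) volume 0 s from
        (hint (continuousOn_dysonCoeff hA ht k) s hs).smul (ε ^ k)]
    simp only [intervalIntegral.integral_smul, Finset.smul_sum, smul_smul, ← pow_succ']
    rfl
  have hW : ∀ n, ∀ s ∈ Icc 0 t, ‖Y s - P n s‖ ≤ C * (‖ε‖ * (2 / K)) ^ n * E s := by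
    intro n
    induction n with
    | zero =>
      intro s hs
      simp only [hP, Finset.range_zero, Finset.sum_empty, sub_zero, pow_zero, mul_one]
      exact (hC s hs).trans (le_mul_of_one_le_right hC0 (hE1 s hs))
    | succ n ih =>
      intro s hs
      have h1 := norm_integral_mul_le hA hK (by positivity) ih hs
      have h2 : Y s - P (n + 1) s = ε • ∫ r in (0 : ℝ)..s, A r * (Y r - P n r) := by
        rw [hYe s hs, hPs n s hs, add_sub_add_left_eq_sub, ← smul_sub,
          ← intervalIntegral.integral_sub (hint hY s hs) (hint (hPc n) s hs)]
        simp only [mul_sub]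
      rw [h2, norm_smul]
      refine (mul_le_mul_of_nonneg_left h1 (norm_nonneg ε)).trans (le_of_eq ?_)
      ring
  have hsum : Summable fun n => ε ^ n • dysonCoeff A n s := by
    refine Summable.of_norm_bounded (g := fun n => (‖(1 : 𝔸)‖ * E s) * (‖ε‖ * (2 / K)) ^ n)
      ((summable_geometric_of_lt_one hq0 hKε).mul_left _) fun n => ?_
    rw [norm_smul, norm_pow]
    refine (mul_le_mul_of_nonneg_left (norm_dysonCoeff_le hA hK n s hs)
      (by positivity)).trans (le_of_eq ?_)
    rw [mul_pow]; ring
  have hlim : Tendsto (fun n => P n s) atTop (𝓝 (Y s)) := by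
    rw [tendsto_iff_norm_sub_tendsto_zero]
    refine squeeze_zero (fun _ => norm_nonneg _)
      (fun n => (norm_sub_rev _ _).trans_le (hW n s hs)) ?_
    have := ((tendsto_pow_atTop_nhds_zero_of_lt_one hq0 hKε).const_mul C).mul_const (E s)
    simpa using this
  exact (hsum.hasSum_iff_tendsto_nat).2 hlim

theorem analyticAt_dysonSeries (hA : IntervalIntegrable A volume 0 t) {s : ℝ} (hs : s ∈ Icc 0 t)
    (ε₀ : ℂ) : AnalyticAt ℂ (fun ε : ℂ => ∑' n, ε ^ n • dysonCoeff A n s) ε₀ := by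
  set ρ := ‖ε₀‖ + 1 with hρ
  have hρ0 : 0 < ρ := by positivity
  have hd : DifferentiableOn ℂ (fun ε : ℂ => ∑' n, ε ^ n • dysonCoeff A n s)
      (Metric.ball 0 ρ) := by
    refine Complex.differentiableOn_tsum_of_summable_norm
      (u := fun n => (‖(1 : 𝔸)‖ * Real.exp (4 * ρ * ∫ x in (0 : ℝ)..s, ‖A x‖)) * (1 / 2) ^ n)
      (summable_geometric_two.mul_left _) (fun n => by fun_prop) Metric.isOpen_ball
      fun n ε hε => ?_
    rw [norm_smul, norm_pow]
    rw [mem_ball_zero_iff] at hε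
    have h1 := norm_dysonCoeff_le hA (show 0 < 4 * ρ by positivity) n s hs
    have h2 : ρ * (2 / (4 * ρ)) = 1 / 2 := by field_simp; norm_num
    refine (mul_le_mul (pow_le_pow_left₀ (norm_nonneg ε) hε.le n) h1 (norm_nonneg _)
      (by positivity)).trans (le_of_eq ?_)
    rw [← h2, mul_pow]; ring
  exact hd.analyticAt (Metric.isOpen_ball.mem_nhds (by simp [hρ]))

end Entire

/-! ### Rotation of trajectories -/

section Angle

/-- The sine of the angle between `x` and `y` is at most `‖y - x‖ / ‖x‖`. -/
theorem angle_le_arcsin {V : Type*} [NormedAddCommGroup V] [InnerProductSpace ℝ V] {x y : V}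
    (hx : x ≠ 0) (hy : y ≠ 0) {ρ : ℝ} (hρ : ρ < 1) (h : ‖y - x‖ ≤ ρ * ‖x‖) :
    InnerProductGeometry.angle x y ≤ Real.arcsin ρ := by
  have hx0 : 0 < ‖x‖ := norm_pos_iff.2 hx
  have hy0 : 0 < ‖y‖ := norm_pos_iff.2 hy
  have hρ0 : 0 ≤ ρ := by
    by_contra hneg
    have := norm_nonneg (y - x)
    nlinarith
  have hsq : ‖y - x‖ ^ 2 = ‖y‖ ^ 2 - 2 * inner ℝ x y + ‖x‖ ^ 2 := by
    rw [norm_sub_sq_real, real_inner_comm]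
  have hle : ‖y - x‖ ^ 2 ≤ (ρ * ‖x‖) ^ 2 := pow_le_pow_left₀ (norm_nonneg _) h 2
  have hρ2 : ρ ^ 2 ≤ 1 := by nlinarith
  have hin : 0 ≤ inner ℝ x y := by nlinarith [sq_nonneg ‖y‖, sq_nonneg ‖x‖]
  have hang : InnerProductGeometry.angle x y ≤ Real.pi / 2 :=
    Real.arccos_le_pi_div_two.2 (by positivity)
  -- `‖x‖² ‖y‖² - ⟪x, y⟫² = ‖y - x‖² ‖y‖² - (‖y‖² - ⟪x, y⟫)²`
  have hsin : Real.sin (InnerProductGeometry.angle x y) ≤ ρ := by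
    have h1 := InnerProductGeometry.sin_angle_mul_norm_mul_norm x y
    rw [real_inner_self_eq_norm_sq, real_inner_self_eq_norm_sq] at h1
    have h2 : √(‖x‖ ^ 2 * ‖y‖ ^ 2 - inner ℝ x y * inner ℝ x y) ≤ ρ * ‖x‖ * ‖y‖ := by
      refine Real.sqrt_le_iff.2 ⟨by positivity, ?_⟩
      rw [mul_pow (ρ * ‖x‖)]
      nlinarith [mul_le_mul_of_nonneg_right hle (sq_nonneg ‖y‖),
        sq_nonneg (‖y‖ ^ 2 - inner ℝ x y)]
    rw [← h1, mul_assoc] at h2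
    exact le_of_mul_le_mul_right h2 (by positivity)
  rw [← Real.arcsin_sin (by linarith [InnerProductGeometry.angle_nonneg x y, Real.pi_pos]) hang]
  exact Real.monotone_arcsin hsin

/-- As `arcsin` has derivative `1` at `0`, short arcs are bounded by their relative chord up to a factor
`1 + η`. -/
theorem eventually_arcsin_le {η : ℝ} (hη : 0 < η) :
    ∀ᶠ δ in 𝓝 (0 : ℝ), 0 ≤ δ → Real.arcsin (δ / (1 - δ)) ≤ (1 + η) * δ := by
  have h1 : HasDerivAt (fun δ : ℝ => δ / (1 - δ)) 1 0 := by
    refine (HasDerivAt.fun_div (hasDerivAt_id' (0 : ℝ)) ((hasDerivAt_id' (0 : ℝ)).const_sub 1)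
      (by simp)).congr_deriv ?_
    simp
  have h2 : HasDerivAt Real.arcsin 1 ((fun δ : ℝ => δ / (1 - δ)) 0) := by
    have := Real.hasDerivAt_arcsin (x := 0) (by norm_num) (by norm_num)
    simpa using this
  have h3 : HasDerivAt (fun δ : ℝ => Real.arcsin (δ / (1 - δ))) (1 * 1) 0 :=
    HasDerivAt.comp (h := fun δ : ℝ => δ / (1 - δ)) 0 h2 h1
  have h4 := (hasDerivAt_iff_isLittleO.1 h3).def hη
  filter_upwards [h4] with δ hδ h0
  simp only [sub_zero, zero_div, Real.arcsin_zero, mul_one, smul_eq_mul, Real.norm_eq_abs,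
    abs_of_nonneg h0] at hδ
  linarith [(abs_le.1 hδ).2]

variable {H : Type*} [NormedAddCommGroup H] [InnerProductSpace ℂ H]
  {A Y : ℝ → H →L[ℂ] H} {ε : ℂ} {t : ℝ}

/-- The length `|ε| ∫₀ˢ ‖A‖` of the time interval `[0, s]` for the equation `Y' = ε A Y`. -/
noncomputable def growth (A : ℝ → H →L[ℂ] H) (ε : ℂ) (s : ℝ) : ℝ :=
  ‖ε‖ * ∫ r in (0 : ℝ)..s, ‖A r‖

theorem continuousOn_growth (hA : IntervalIntegrable A volume 0 t) (ht : 0 ≤ t) :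
    ContinuousOn (growth A ε) (Icc 0 t) :=
  continuousOn_const.mul (continuousOn_integral hA.norm ht)

theorem growth_sub (hA : IntervalIntegrable A volume 0 t) {s s' : ℝ} (hs : 0 ≤ s) (hss : s ≤ s')
    (hst : s' ≤ t) : growth A ε s' - growth A ε s = ‖ε‖ * ∫ r in s..s', ‖A r‖ := by
  rw [growth, growth, ← mul_sub, intervalIntegral.integral_interval_sub_left
    (intervalIntegrable_sub hA.norm le_rfl (hs.trans hss) hst)
    (intervalIntegrable_sub hA.norm le_rfl hs (hss.trans hst))]

theorem growth_mono (hA : IntervalIntegrable A volume 0 t) {s s' : ℝ} (hs : 0 ≤ s) (hss : s ≤ s')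
    (hst : s' ≤ t) : growth A ε s ≤ growth A ε s' :=
  sub_nonneg.1 (growth_sub hA hs hss hst ▸ mul_nonneg (norm_nonneg _)
    (intervalIntegral.integral_nonneg hss fun _ _ => norm_nonneg _))

variable [CompleteSpace H]

theorem IsSolution.zero (hY : IsSolution A ε t Y) (ht : 0 ≤ t) : Y 0 = 1 := by
  rw [hY.integral_eq 0 ⟨le_rfl, ht⟩, intervalIntegral.integral_same, smul_zero, add_zero]

theorem IsSolution.continuousOn_apply (hY : IsSolution A ε t Y) (x : H) :
    ContinuousOn (fun s => Y s x) (Icc 0 t) :=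
  (ContinuousLinearMap.apply ℂ H x).continuous.comp_continuousOn hY.continuousOn

theorem IsSolution.norm_sub_le (hY : IsSolution A ε t Y) (hA : IntervalIntegrable A volume 0 t)
    (x : H) {s s' M : ℝ} (hs : 0 ≤ s) (hss : s ≤ s') (hst : s' ≤ t)
    (hM : ∀ r ∈ Icc s s', ‖Y r x‖ ≤ M) :
    ‖Y s' x - Y s x‖ ≤ (growth A ε s' - growth A ε s) * M := by
  have ht : 0 ≤ t := hs.trans (hss.trans hst)
  have hi : ∀ {a b : ℝ}, 0 ≤ a → a ≤ b → b ≤ t →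
      IntervalIntegrable (fun r => A r * Y r) volume a b := fun h1 h2 h3 =>
    (intervalIntegrable_mul hA ht hY.continuousOn).mono_set (by
      rw [uIcc_of_le h2, uIcc_of_le ht]; exact Icc_subset_Icc h1 h3)
  have h1 : Y s' x - Y s x = ε • ∫ r in s..s', (A r * Y r) x := by
    have := (ContinuousLinearMap.apply ℂ H x).intervalIntegral_comp_comm (hi hs hss hst)
    simp only [ContinuousLinearMap.apply_apply] at this
    rw [this, ← intervalIntegral.integral_interval_sub_left (hi le_rfl (hs.trans hss) hst)
      (hi le_rfl hs (hss.trans hst)), hY.integral_eq s' ⟨hs.trans hss, hst⟩,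
      hY.integral_eq s ⟨hs, hss.trans hst⟩]
    simp [smul_sub]
  rw [h1, norm_smul, growth_sub hA hs hss hst, mul_assoc]
  refine mul_le_mul_of_nonneg_left ?_ (norm_nonneg ε)
  rw [← intervalIntegral.integral_mul_const]
  refine intervalIntegral.norm_integral_le_of_norm_le hss (ae_of_all _ fun r hr => ?_)
    ((intervalIntegrable_sub hA.norm hs hss hst).mul_const M)
  exact ((A r).le_opNorm (Y r x)).trans
    (mul_le_mul_of_nonneg_left (hM r ⟨hr.1.le, hr.2⟩) (norm_nonneg _))

/-- Over a short time interval of length `δ < 1`, a trajectory moves by at most `δ / (1 - δ)`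
relative to its initial value. -/
theorem IsSolution.norm_sub_le_div (hY : IsSolution A ε t Y)
    (hA : IntervalIntegrable A volume 0 t) (x : H) {s s' : ℝ} (hs : 0 ≤ s) (hss : s ≤ s')
    (hst : s' ≤ t) (hδ : growth A ε s' - growth A ε s < 1) :
    ‖Y s' x - Y s x‖ ≤ (growth A ε s' - growth A ε s) /
      (1 - (growth A ε s' - growth A ε s)) * ‖Y s x‖ := by
  set δ := growth A ε s' - growth A ε s with hδd
  have hδ0 : 0 ≤ δ := sub_nonneg.2 (growth_mono hA hs hss hst)
  obtain ⟨r, hr, hmax⟩ := isCompact_Icc.exists_isMaxOn (nonempty_Icc.2 hss)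
    ((hY.continuousOn_apply x).norm.mono (Icc_subset_Icc hs hst))
  have hM : ∀ r' ∈ Icc s s', ‖Y r' x‖ ≤ ‖Y r x‖ := fun r' hr' => hmax hr'
  have h1 := hY.norm_sub_le hA x hs hss hst hM
  have h2 := hY.norm_sub_le hA x hs hr.1 (hr.2.trans hst) fun r' hr' =>
    hM r' ⟨hr'.1, hr'.2.trans hr.2⟩
  have h3 : growth A ε r - growth A ε s ≤ δ :=
    sub_le_sub_right (growth_mono hA (hs.trans hr.1) hr.2 hst) _
  have h4 : ‖Y r x‖ ≤ ‖Y s x‖ + δ * ‖Y r x‖ := by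
    have := norm_sub_norm_le (Y r x) (Y s x)
    nlinarith [norm_nonneg (Y r x)]
  have h5 : ‖Y r x‖ ≤ ‖Y s x‖ / (1 - δ) := by
    rw [le_div_iff₀ (by linarith)]; linarith
  calc _ ≤ δ * ‖Y r x‖ := h1
    _ ≤ δ * (‖Y s x‖ / (1 - δ)) := mul_le_mul_of_nonneg_left h5 hδ0
    _ = _ := by ring

/-- Trajectories are bounded below. The factor `2` absorbs the error in
`1 - δ / (1 - δ) ≥ e^{-2δ}`, valid for `δ ≤ 1 / 4`; it is harmless, as only positivity is used. -/
theorem IsSolution.le_norm (hY : IsSolution A ε t Y) (hA : IntervalIntegrable A volume 0 t)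
    (x : H) {s : ℝ} (hs : s ∈ Icc 0 t) :
    ‖x‖ * Real.exp (-(2 * growth A ε s)) ≤ ‖Y s x‖ := by
  have ht : 0 ≤ t := hs.1.trans hs.2
  have hg := continuousOn_growth (ε := ε) hA ht
  have hy := hY.continuousOn_apply x
  have key := le_of_eventually_sub_le_sub
    (f := fun s => -(‖Y s x‖ * Real.exp (2 * growth A ε s))) (g := fun _ => -‖x‖)
    (by fun_prop) continuousOn_const (by simp [hY.zero ht, growth]) ?_ s hs
  · rw [Real.exp_neg, ← div_eq_mul_inv, div_le_iff₀ (Real.exp_pos _)]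
    linarith
  intro s hs
  filter_upwards [(tendsto_increment hg hs).eventually
    (gt_mem_nhds (show (0 : ℝ) < 1 / 4 by norm_num)), self_mem_nhdsWithin] with s' h1 h2 h3
  have h2 : s ≤ s' := le_of_lt h2
  have h4 := hY.norm_sub_le_div hA x hs.1 h2 h3 (by linarith)
  set δ := growth A ε s' - growth A ε s with hδd
  have hδ0 : 0 ≤ δ := sub_nonneg.2 (growth_mono hA hs.1 h2 h3)
  have e1 : Real.exp (2 * growth A ε s') = Real.exp (2 * growth A ε s) * Real.exp (2 * δ) := by
    rw [← Real.exp_add, hδd]; ring_nf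
  have e2 : 1 + 2 * δ ≤ Real.exp (2 * δ) := by linarith [Real.add_one_le_exp (2 * δ)]
  have e3 : δ / (1 - δ) ≤ 4 / 3 * δ := by
    rw [div_le_iff₀ (by linarith)]; nlinarith
  have e4 : ‖Y s x‖ * (1 - 4 / 3 * δ) ≤ ‖Y s' x‖ := by
    have h5 := norm_sub_norm_le (Y s x) (Y s' x)
    rw [norm_sub_rev] at h5
    nlinarith [mul_le_mul_of_nonneg_right e3 (norm_nonneg (Y s x))]
  have e5 : ‖Y s x‖ ≤ ‖Y s' x‖ * Real.exp (2 * δ) := by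
    calc ‖Y s x‖ ≤ ‖Y s x‖ * ((1 - 4 / 3 * δ) * (1 + 2 * δ)) :=
          le_mul_of_one_le_right (norm_nonneg _) (by nlinarith)
      _ ≤ ‖Y s' x‖ * (1 + 2 * δ) := by
          rw [← mul_assoc]; exact mul_le_mul_of_nonneg_right e4 (by linarith)
      _ ≤ _ := mul_le_mul_of_nonneg_left e2 (norm_nonneg _)
  rw [e1]
  nlinarith [mul_le_mul_of_nonneg_right e5 (Real.exp_pos (2 * growth A ε s)).le]

/-- A trajectory turns by an angle of at most `|ε| ∫ ‖A‖`, measured in the real Hilbert space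
underlying `H`. -/
theorem IsSolution.angle_le (hY : IsSolution A ε t Y) (hA : IntervalIntegrable A volume 0 t)
    {x : H} (hx : x ≠ 0) {s : ℝ} (hs : s ∈ Icc 0 t) :
    InnerProductGeometry.angle x (Y s x) ≤ growth A ε s := by
  have ht : 0 ≤ t := hs.1.trans hs.2
  have hg := continuousOn_growth (ε := ε) hA ht
  have hne : ∀ s ∈ Icc 0 t, Y s x ≠ 0 := fun s hs => norm_pos_iff.1
    (lt_of_lt_of_le (mul_pos (norm_pos_iff.2 hx) (Real.exp_pos _)) (hY.le_norm hA x hs))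
  have hη : ∀ η : ℝ, 0 < η → InnerProductGeometry.angle x (Y s x) ≤ (1 + η) * growth A ε s := by
    intro η hη
    refine le_of_eventually_sub_le_sub
      (f := fun s => InnerProductGeometry.angle x (Y s x)) (g := fun s => (1 + η) * growth A ε s)
      (fun s hs => ?_) (by fun_prop) ?_ ?_ s hs
    · exact ContinuousAt.comp_continuousWithinAt (f := fun s => (x, Y s x))
        (InnerProductGeometry.continuousAt_angle (x := (x, Y s x)) hx (hne s hs))
        (continuousWithinAt_const.prodMk (hY.continuousOn_apply x s hs))
    · simp [hY.zero ht, growth, InnerProductGeometry.angle_self hx]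
    · intro s hs
      filter_upwards [(tendsto_increment hg hs).eventually (eventually_arcsin_le hη),
        (tendsto_increment hg hs).eventually
          (gt_mem_nhds (show (0 : ℝ) < 1 / 2 by norm_num)), self_mem_nhdsWithin] with s' h0 h1 h2 h3
      have h2 : s ≤ s' := le_of_lt h2
      have hδ0 := sub_nonneg.2 (growth_mono (ε := ε) hA hs.1 h2 h3)
      have h4 := hY.norm_sub_le_div hA x hs.1 h2 h3 (by linarith)
      have h5 := angle_le_arcsin (hne s (Ico_subset_Icc_self hs)) (hne s' ⟨hs.1.trans h2, h3⟩)
        (by rw [div_lt_one (by linarith)]; linarith) h4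
      have h6 := InnerProductGeometry.angle_le_angle_add_angle x (Y s x) (Y s' x)
      have h7 := h0 hδ0
      linarith
  have hlim : Tendsto (fun η : ℝ => (1 + η) * growth A ε s) (𝓝[>] 0)
      (𝓝 ((1 + 0) * growth A ε s)) :=
    ((continuous_const.add continuous_id).mul continuous_const).continuousAt.mono_left
      nhdsWithin_le_nhds
  rw [add_zero, one_mul] at hlim
  exact ge_of_tendsto hlim (by filter_upwards [self_mem_nhdsWithin] with η h using hη η h)

end Angle

section Segment

variable {H : Type*} [NormedAddCommGroup H] [InnerProductSpace ℂ H] {T : H →L[ℂ] H}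

/-- If `T` turns no vector by more than `c < π` and is bounded below, then so are the operators
`(1 - u) + u T`, `0 ≤ u ≤ 1`. -/
theorem exists_le_norm_segmentPath {c m : ℝ} (hc : c < Real.pi) (hm : 0 < m)
    (hang : ∀ x : H, x ≠ 0 → InnerProductGeometry.angle x (T x) ≤ c)
    (hbd : ∀ x : H, m * ‖x‖ ≤ ‖T x‖) {u : ℝ} (hu : u ∈ Icc (0 : ℝ) 1) :
    ∃ κ : ℝ, 0 < κ ∧ ∀ x : H, κ * ‖x‖ ≤ ‖segmentPath T u x‖ := by
  rcases subsingleton_or_nontrivial H with hH | hH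
  · exact ⟨1, one_pos, fun x => by simp [Subsingleton.elim x 0]⟩
  obtain ⟨x₀, hx₀⟩ := exists_ne (0 : H)
  have hc0 : 0 ≤ c := (InnerProductGeometry.angle_nonneg _ _).trans (hang x₀ hx₀)
  have hcos : -1 < Real.cos c := by
    rw [← Real.cos_pi]
    exact Real.strictAntiOn_cos ⟨hc0, hc.le⟩ ⟨Real.pi_pos.le, le_rfl⟩ hc
  obtain ⟨q, hq0, hq1, hqc⟩ : ∃ q : ℝ, 0 ≤ q ∧ q < 1 ∧ -q ≤ Real.cos c :=
    ⟨max 0 (-Real.cos c), le_max_left _ _, max_lt one_pos (by linarith),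
      by linarith [le_max_right 0 (-Real.cos c)]⟩
  set κ2 := (1 - q) * ((1 - u) ^ 2 + u ^ 2 * m ^ 2) with hκ2
  have hκ : 0 < κ2 := by
    refine mul_pos (by linarith) ?_
    rcases hu.1.eq_or_lt with h | h
    · simp [← h]
    · positivity
  refine ⟨√κ2, Real.sqrt_pos.2 hκ, fun x => ?_⟩
  rcases eq_or_ne x 0 with rfl | hx
  · simp
  have hform : segmentPath T u x = (1 - u) • x + u • T x := by
    simp only [segmentPath, add_apply, smul_apply,
      sub_apply, one_apply_eq_self, Complex.coe_smul]
    module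
  have hin : -q * (‖x‖ * ‖T x‖) ≤ inner ℝ x (T x) := by
    rw [← InnerProductGeometry.cos_angle_mul_norm_mul_norm]
    refine mul_le_mul_of_nonneg_right (hqc.trans ?_) (by positivity)
    exact Real.strictAntiOn_cos.antitoneOn
      ⟨InnerProductGeometry.angle_nonneg _ _, InnerProductGeometry.angle_le_pi _ _⟩
      ⟨hc0, hc.le⟩ (hang x hx)
  have hu1 : 0 ≤ 1 - u := by linarith [hu.2]
  have hsq : ‖segmentPath T u x‖ ^ 2 =
      (1 - u) ^ 2 * ‖x‖ ^ 2 + 2 * ((1 - u) * u * inner ℝ x (T x)) + u ^ 2 * ‖T x‖ ^ 2 := by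
    rw [hform, norm_add_sq_real, norm_smul, norm_smul, real_inner_smul_left,
      real_inner_smul_right, Real.norm_eq_abs, Real.norm_eq_abs, mul_pow, mul_pow, sq_abs, sq_abs]
    ring
  have hTx : m ^ 2 * ‖x‖ ^ 2 ≤ ‖T x‖ ^ 2 := by
    rw [← mul_pow]; exact pow_le_pow_left₀ (by positivity) (hbd x) 2
  refine le_of_sq_le_sq ?_ (norm_nonneg _)
  rw [mul_pow, Real.sq_sqrt hκ.le, hsq]
  have h1 := mul_le_mul_of_nonneg_left hin (mul_nonneg hu1 hu.1)
  -- `2 (1 - u) u ⟪x, T x⟫ ≥ -q ((1 - u)² ‖x‖² + u² ‖T x‖²)`, by `h1` and the square in `h2`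
  have h2 : 0 ≤ q * ((1 - u) * ‖x‖ - u * ‖T x‖) ^ 2 := mul_nonneg hq0 (sq_nonneg _)
  have h3 : 0 ≤ (1 - q) * u ^ 2 * (‖T x‖ ^ 2 - m ^ 2 * ‖x‖ ^ 2) :=
    mul_nonneg (mul_nonneg (by linarith) (sq_nonneg u)) (by linarith)
  rw [hκ2]
  nlinarith

variable [CompleteSpace H]

theorem isStarNormal_segmentPath (hT : IsStarNormal T) (u : ℝ) :
    IsStarNormal (segmentPath T u) := by
  refine ⟨?_⟩
  have h1 : star (segmentPath T u) = segmentPath (star T) u := by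
    simp [segmentPath]
  rw [h1]
  exact commute_segmentPath (commute_segmentPath hT.star_comm_self.symm u).symm u

/-- A normal operator, or an operator on a finite dimensional space, is invertible if it is bounded
below. -/
theorem isUnit_of_le_norm {S : H →L[ℂ] H} (hS : FiniteDimensional ℂ H ∨ IsStarNormal S) {κ : ℝ}
    (hκ : 0 < κ) (h : ∀ x, κ * ‖x‖ ≤ ‖S x‖) : IsUnit S := by
  rw [ContinuousLinearMap.isUnit_iff_bijective]
  have hanti : AntilipschitzWith (Real.toNNReal κ⁻¹) S :=
    S.antilipschitz_of_bound fun x => by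
      rw [Real.coe_toNNReal _ (by positivity), inv_mul_eq_div, le_div_iff₀ hκ, mul_comm]
      exact h x
  have hinj : Function.Injective S := hanti.injective
  rcases hS with hS | hS
  · exact ⟨hinj, LinearMap.surjective_of_injective (f := (S : H →ₗ[ℂ] H)) hinj⟩
  · rw [ContinuousLinearMap.bijective_iff_dense_range_and_antilipschitz]
    refine ⟨?_, _, hanti⟩
    rw [Submodule.topologicalClosure_eq_top_iff, ContinuousLinearMap.IsStarNormal.orthogonal_range hS, LinearMap.ker_eq_bot]
    exact hinj

theorem IsSolution.segmentUnits {A Y : ℝ → H →L[ℂ] H} {ε : ℂ} {t : ℝ} (hY : IsSolution A ε t Y)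
    (hA : IntervalIntegrable A volume 0 t) (ht : 0 ≤ t) (hε : ε ∈ disc A t Real.pi)
    (hn : FiniteDimensional ℂ H ∨ IsStarNormal (Y t)) : SegmentUnits (Y t) := by
  intro u hu
  obtain ⟨κ, hκ, h⟩ := exists_le_norm_segmentPath (T := Y t) (c := growth A ε t) hε
    (Real.exp_pos (-(2 * growth A ε t))) (fun x hx => hY.angle_le hA hx ⟨ht, le_rfl⟩)
    (fun x => by rw [mul_comm]; exact hY.le_norm hA x ⟨ht, le_rfl⟩) hu
  exact isUnit_of_le_norm (hn.imp_right fun h' => isStarNormal_segmentPath h' u) hκ h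

end Segment

end Magnus

theorem theorem3 {H : Type*} [NormedAddCommGroup H] [InnerProductSpace ℂ H] [CompleteSpace H]
    (A : ℝ → H →L[ℂ] H) (t : ℝ) (ht : 0 ≤ t)
    (hA : IntervalIntegrable A volume 0 t)
    (Y : ℂ → ℝ → H →L[ℂ] H) (hY : ∀ ε : ℂ, Magnus.IsSolution A ε t (Y ε)) :
    ∀ ε₀ ∈ Magnus.disc A t Real.pi,
      (FiniteDimensional ℂ H ∨ IsStarNormal (Y ε₀ t)) →
        (∀ᶠ ε in nhds ε₀, Magnus.LogDefined (Y ε t) ∧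
          NormedSpace.exp (Magnus.opLog (Y ε t)) = Y ε t) ∧
        AnalyticAt ℂ (fun ε : ℂ => Magnus.opLog (Y ε t)) ε₀ := by
  intro ε₀ hε₀ hn
  have hS := (hY ε₀).segmentUnits hA ht hε₀ hn
  have hYt : AnalyticAt ℂ (fun ε => Y ε t) ε₀ := by
    refine (Magnus.analyticAt_dysonSeries hA ⟨ht, le_rfl⟩ ε₀).congr 
      (Filter.Eventually.of_forall fun ε => ?_)
    exact (Magnus.hasSum_dysonCoeff hA (hY ε).continuousOn (hY ε).integral_eq
      ⟨ht, le_rfl⟩).tsum_eq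
  have hev : ∀ᶠ ε in nhds ε₀, Magnus.SegmentUnits (Y ε t) :=
    hYt.continuousAt.eventually hS.eventually
  refine ⟨hev.mono fun ε h => ⟨h.logDefined, ?_⟩, ?_⟩
  · rw [h.logDefined.opLog_eq, h.exp_segmentLog]
  · exact (AnalyticAt.comp (f := fun ε => Y ε t) hS.analyticAt_segmentLog hYt).congr
      (hev.mono fun ε h => h.logDefined.opLog_eq.symm)
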